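/- A representation of a set $X$ is a surjective partial function $\delta:\subseteq\mathbb{N}^{\mathbb{N}}\to X$; $p$ is a name of $x$ if $\delta(p)=x$. A partial function $F:\subseteq\mathbb{N}^{\mathbb{N}}\to\mathbb{N}^{\mathbb{N}}$ realizes a partial multi-valued function $f:\subseteq X\rightrightarrows Y$ between represented spaces, written $F\vdash f$, if for every name $p$ of a point $x\in\mathrm{dom}(f)$, $F(p)$ is defined and is a name of an element of $f(x)$. We write $f\leq_{\mathrm W}g$ if there are (Type-2) computable partial functions $H,K:\subseteq\mathbb{N}^{\mathbb{N}}\to\mathbb{N}^{\mathbb{N}}$ such that $\big(p\mapsto H\langle p,G(K(p))\rangle\big)\vdash f$ whenever $G\vdash g$, and $f\equiv_{\mathrm W}g$ (Weihrauch equivalence) if $f\leq_{\mathrm W}g$ and $g\leq_{\mathrm W}f$. Fix an effective enumeration $\alpha$ of $\mathbb{Q}^n$ and an effective enumeration $(B_k)_k$ of the open balls of $\mathbb{R}^n$ (with the Euclidean metric $d$) with centre in $\mathbb{Q}^n$ and nonnegative rational radius. A name of $x\in\mathbb{R}^n$ is a $p$ with $d(\alpha(p(i)),\alpha(p(j)))\le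 2^{-i}$ for all $i\le j$ and $\lim_i\alpha(p(i))=x$; a positive-information name of a nonempty closed $A\subseteq\mathbb{R}^n$ is a $p$ whose range is $\{k: B_k\cap A\neq\emptyset\}$; pairs are represented by pairing names, and points of $2^{\mathbb{N}}$ by themselves. For $\varepsilon>0$, the $\varepsilon$-approximate positive projection operator $\varepsilon\text{-}\mathrm{Proj}^+_{\mathbb{R}^n}$ maps a point $x\in\mathbb{R}^n$ and a nonempty closed $A\subseteq\mathbb{R}^n$, given by positive information, to the set of all $y\in A$ with $d(x,y)\le(1+\varepsilon)\,d(x,A)$. The function $\mathrm{Sort}:2^{\mathbb{N}}\to2^{\mathbb{N}}$ is defined by $\mathrm{Sort}(p)=0^m1^{\mathbb{N}}$ if $p$ contains exactly $m$ occurrences of $0$, and $\mathrm{Sort}(p)=0^{\mathbb{N}}$ if $p$ contains infinitely many occurrences of $0$. Then, for every real $\varepsilon>0$ and every $n\ge1$, $$\varepsilon\text{-}\mathrm{Proj}^+_{\mathbb{R}^n}\equiv_{\mathrm W}\mathrm{Sort}.$$ -/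

import Mathlib

open Filter Topology TopologicalSpace Metric

/-! ### Type-2 computability on Baire space -/

/-- The finite word `p(0) … p(k-1)`. -/
def initialWord (p : ℕ → ℕ) (k : ℕ) : List ℕ :=
  List.ofFn fun i : Fin k => p i

/-- Computability of a partial function `F :⊆ ℕ^ℕ → ℕ^ℕ` on Baire space (Type-2 machines): there is
a computable map `h` sending the word of input symbols read so far to the word of output symbols
written so far; written output is never revised (monotonicity), and on every `p ∈ dom F` the words
written are initial words of `F(p)` of unbounded length.  Nothing is required off `dom F`. -/
def TypeTwoComputable (F : (ℕ → ℕ) →. (ℕ → ℕ)) : Prop :=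
  ∃ h : List ℕ → List ℕ, Computable h ∧
    (∀ u v : List ℕ, u <+: v → h u <+: h v) ∧
    ∀ p q : ℕ → ℕ, q ∈ F p →
      (∀ k, ∃ m, h (initialWord p k) = initialWord q m) ∧
      ∀ m, ∃ k, m ≤ (h (initialWord p k)).length

/-- The pairing `⟨p, q⟩` of two elements of Baire space. -/
def pairName (p q : ℕ → ℕ) : ℕ → ℕ := fun i => Nat.pair (p i) (q i)

/-! ### Representations, realizers, Weihrauch reducibility -/

/-- A representation of `X`: a surjective partial function `δ :⊆ ℕ^ℕ → X`, given by its graph;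
`IsName p x` says `δ(p) = x`. -/
structure BaireRep (X : Type*) where
  IsName : (ℕ → ℕ) → X → Prop
  unique : ∀ {p x y}, IsName p x → IsName p y → x = y
  surjective : ∀ x, ∃ p, IsName p x

/-- The product representation: `⟨p, q⟩` names `(x, y)` iff `p` names `x` and `q` names `y`. -/
def BaireRep.prod {X Y : Type*} (δX : BaireRep X) (δY : BaireRep Y) :
    BaireRep (X × Y) where
  IsName r z := ∃ p q, r = pairName p q ∧ δX.IsName p z.1 ∧ δY.IsName q z.2
  unique := by
    rintro r ⟨x, y⟩ ⟨x', y'⟩ ⟨p, q, rfl, hx, hy⟩ ⟨p', q', h, hx', hy'⟩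
    have hpq : ∀ i, p i = p' i ∧ q i = q' i := fun i => Nat.pair_eq_pair.1 (congrFun h i)
    obtain rfl : p = p' := funext fun i => (hpq i).1
    obtain rfl : q = q' := funext fun i => (hpq i).2
    exact Prod.ext (δX.unique hx hx') (δY.unique hy hy')
  surjective := by
    rintro ⟨x, y⟩
    obtain ⟨p, hp⟩ := δX.surjective x
    obtain ⟨q, hq⟩ := δY.surjective y
    exact ⟨_, p, q, rfl, hp, hq⟩

/-- `G ⊢ g` for a partial multi-valued function `g :⊆ X ⇉ Y`, given as `g : X → Set Y` with domain
`{x | g x ≠ ∅}`: whenever `p` names some `x ∈ dom g`, the value `G(p)` is defined and names some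
element of `g x`. -/
def Realizes {X Y : Type*} (δX : BaireRep X) (δY : BaireRep Y)
    (G : (ℕ → ℕ) →. (ℕ → ℕ)) (g : X → Set Y) : Prop :=
  ∀ p x, δX.IsName p x → (g x).Nonempty → ∃ q ∈ G p, ∃ y ∈ g x, δY.IsName q y

/-- `f ≤_W g`: there are computable `H`, `K` such that `p ↦ H⟨p, G(K(p))⟩` realizes `f`
whenever `G` realizes `g`. -/
def WeihrauchReducible {X Y Z W : Type*}
    (δX : BaireRep X) (δY : BaireRep Y) (f : X → Set Y)
    (δZ : BaireRep Z) (δW : BaireRep W) (g : Z → Set W) : Prop :=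
  ∃ H K : (ℕ → ℕ) →. (ℕ → ℕ), TypeTwoComputable H ∧ TypeTwoComputable K ∧
    ∀ G : (ℕ → ℕ) →. (ℕ → ℕ), Realizes δZ δW G g →
      Realizes δX δY (fun p => (K p).bind fun r => (G r).bind fun q => H (pairName p q)) f

/-- `f ≡_W g`. -/
def WeihrauchEquivalent {X Y Z W : Type*}
    (δX : BaireRep X) (δY : BaireRep Y) (f : X → Set Y)
    (δZ : BaireRep Z) (δW : BaireRep W) (g : Z → Set W) : Prop :=
  WeihrauchReducible δX δY f δZ δW g ∧ WeihrauchReducible δZ δW g δX δY f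

/-! ### The function `Sort` on Cantor space -/

/-- Points of Cantor space are named by themselves. -/
def cantorRep : BaireRep (ℕ → Fin 2) where
  IsName p x := ∀ i, p i = (x i : ℕ)
  unique := fun hx hy => funext fun i => Fin.ext ((hx i).symm.trans (hy i))
  surjective := fun x => ⟨fun i => (x i : ℕ), fun _ => rfl⟩

open Classical in
/-- `Sort(p) = 0ⁿ1^ℕ` if `p` has exactly `n` occurrences of `0`, and `Sort(p) = 0^ℕ` if `p` has
infinitely many. -/
noncomputable def sortFun (p : ℕ → Fin 2) : ℕ → Fin 2 :=
  if {i | p i = 0}.Finite then fun m => if m < {i | p i = 0}.ncard then 0 else 1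
  else fun _ => 0

/-! ### Metric spaces with a dense sequence -/

section MetricReps

variable {X : Type*} [MetricSpace X]

/-- The Cauchy representation with respect to the dense sequence `α`. -/
def cauchyRep (α : ℕ → X) (hα : DenseRange α) : BaireRep X where
  IsName p x := (∀ i j, i ≤ j → dist (α (p i)) (α (p j)) ≤ (1 / 2 : ℝ) ^ i) ∧
    Tendsto (fun i => α (p i)) atTop (𝓝 x)
  unique := fun hx hy => tendsto_nhds_unique hx.2 hy.2
  surjective := fun x => by
    have h : ∀ i : ℕ, ∃ k, dist (α k) x < (1 / 2 : ℝ) ^ i / 2 := fun i => by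
      obtain ⟨k, hk⟩ := hα.exists_dist_lt x (show (0 : ℝ) < (1 / 2 : ℝ) ^ i / 2 by positivity)
      exact ⟨k, by rwa [dist_comm]⟩
    choose p hp using h
    refine ⟨p, fun i j hij => ?_, ?_⟩
    · have h1 := dist_triangle_right (α (p i)) (α (p j)) x
      have h2 : (1 / 2 : ℝ) ^ j ≤ (1 / 2 : ℝ) ^ i :=
        pow_le_pow_of_le_one (by norm_num) (by norm_num) hij
      linarith [hp i, hp j]
    · rw [tendsto_iff_dist_tendsto_zero]
      have h0 : Tendsto (fun i : ℕ => (1 / 2 : ℝ) ^ i / 2) atTop (𝓝 0) := by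
        simpa using (tendsto_pow_atTop_nhds_zero_of_lt_one (r := (1 / 2 : ℝ))
          (by norm_num) (by norm_num)).div_const 2
      exact squeeze_zero (fun _ => dist_nonneg) (fun i => (hp i).le) h0

/-- An effective enumeration of the nonnegative rational numbers. -/
def nonnegRatEnum (m : ℕ) : ℚ := (m.unpair.1 : ℚ) / ((m.unpair.2 : ℚ) + 1)

/-- The basic open ball `B_k = B(α(n), q_m)`, `k = ⟨n, m⟩`. -/
def basicBall (α : ℕ → X) (k : ℕ) : Set X :=
  ball (α k.unpair.1) (nonnegRatEnum k.unpair.2 : ℝ)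

theorem exists_nonnegRatEnum_eq {q : ℚ} (hq : 0 ≤ q) : ∃ m, nonnegRatEnum m = q := by
  refine ⟨Nat.pair q.num.toNat (q.den - 1), ?_⟩
  have h1 : ((q.num.toNat : ℤ)) = q.num := Int.toNat_of_nonneg (Rat.num_nonneg.2 hq)
  have h2 : ((q.den - 1 : ℕ) : ℚ) + 1 = q.den := by
    exact_mod_cast Nat.sub_add_cancel q.pos
  have h3 : ((q.num.toNat : ℕ) : ℚ) = (q.num : ℚ) := by exact_mod_cast congrArg (Int.cast : ℤ → ℚ) h1
  simp only [nonnegRatEnum, Nat.unpair_pair]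
  rw [h2, h3, Rat.num_div_den]

theorem exists_basicBall_mem {α : ℕ → X} (hα : DenseRange α) (x : X) {r : ℝ} (hr : 0 < r) :
    ∃ k, x ∈ basicBall α k ∧ basicBall α k ⊆ ball x r := by
  obtain ⟨n, hn⟩ := hα.exists_dist_lt x (half_pos hr)
  obtain ⟨q, hq1, hq2⟩ := exists_rat_btwn hn
  have hq0 : (0 : ℝ) ≤ q := dist_nonneg.trans hq1.le
  obtain ⟨m, hm⟩ := exists_nonnegRatEnum_eq (q := q) (by exact_mod_cast hq0)
  refine ⟨Nat.pair n m, ?_, ?_⟩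
  · simpa [basicBall, hm] using hq1
  · intro y hy
    simp only [basicBall, Nat.unpair_pair, hm, mem_ball] at hy ⊢
    have h1 := dist_triangle y (α n) x
    rw [dist_comm (α n) x] at h1
    linarith

/-- The nonempty closed subsets of `X`. -/
abbrev NonemptyClosed (X : Type*) [MetricSpace X] : Type _ :=
  {A : Set X // IsClosed A ∧ A.Nonempty}

/-- Positive information on closed sets: `p` names `A` iff `p` enumerates exactly the indices of the
basic open balls that meet `A`.  (As `range p` is never empty, only nonempty sets have names.) -/
def positiveRep (α : ℕ → X) (hα : DenseRange α) : BaireRep (NonemptyClosed X) where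
  IsName p A := ∀ k, k ∈ Set.range p ↔ (basicBall α k ∩ A.1).Nonempty
  unique := by
    have key : ∀ (A B : NonemptyClosed X),
        (∀ k, (basicBall α k ∩ A.1).Nonempty → (basicBall α k ∩ B.1).Nonempty) → A.1 ⊆ B.1 := by
      intro A B h x hx
      by_contra hxB
      obtain ⟨r, hr, hrB⟩ := Metric.isOpen_iff.1 B.2.1.isOpen_compl x hxB
      obtain ⟨k, hk1, hk2⟩ := exists_basicBall_mem hα x hr
      obtain ⟨y, hy1, hy2⟩ := h k ⟨x, hk1, hx⟩
      exact hrB (hk2 hy1) hy2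
    intro p A B hA hB
    exact Subtype.ext (Set.Subset.antisymm
      (key A B fun k hk => (hB k).1 ((hA k).2 hk)) (key B A fun k hk => (hA k).1 ((hB k).2 hk)))
  surjective := fun A => by
    obtain ⟨x, hx⟩ := A.2.2
    obtain ⟨k, hk, -⟩ := exists_basicBall_mem hα x one_pos
    obtain ⟨p, hp⟩ := (Set.to_countable {k | (basicBall α k ∩ A.1).Nonempty}).exists_eq_range
      ⟨k, x, hk, hx⟩
    exact ⟨p, fun k => by rw [← hp]; rfl⟩

/-- The `ε`-projection points of `x` onto `A`: the `y ∈ A` with `d(x, y) ≤ (1 + ε) d(x, A)`. -/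
def approxProj (ε : ℝ) (z : X × NonemptyClosed X) : Set X :=
  {y | y ∈ z.2.1 ∧ dist z.1 y ≤ (1 + ε) * infDist z.1 z.2.1}

end MetricReps

/-! ### Euclidean space with the rational points -/

/-- An effective enumeration of `ℚ`: `⟨⟨a, b⟩, c⟩ ↦ (a - b) / (c + 1)`. -/
def ratEnum (k : ℕ) : ℚ :=
  ((k.unpair.1.unpair.1 : ℚ) - (k.unpair.1.unpair.2 : ℚ)) / ((k.unpair.2 : ℚ) + 1)

/-- The `i`-th entry of the sequence `⟨k₀, ⟨k₁, ⟨k₂, …⟩⟩⟩` coded by `k`. -/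
def codeEntry (k i : ℕ) : ℕ := (Nat.unpair ((fun m => (Nat.unpair m).2)^[i] k)).1

/-- An effective enumeration of `ℚⁿ`, as a sequence in Euclidean `ℝⁿ`. -/
noncomputable def ratPoint (n : ℕ) (k : ℕ) : EuclideanSpace ℝ (Fin n) :=
  WithLp.toLp 2 fun i => ((ratEnum (codeEntry k i) : ℚ) : ℝ)

theorem ratEnum_surjective : Function.Surjective ratEnum := fun q => by
  refine ⟨Nat.pair (Nat.pair q.num.toNat (-q.num).toNat) (q.den - 1), ?_⟩
  have h1 : ((q.num.toNat : ℤ)) - ((-q.num).toNat : ℤ) = q.num := Int.toNat_sub_toNat_neg _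
  have h2 : ((q.den - 1 : ℕ) : ℚ) + 1 = q.den := by
    exact_mod_cast Nat.sub_add_cancel q.pos
  have h3 : ((q.num.toNat : ℕ) : ℚ) - (((-q.num).toNat : ℕ) : ℚ) = (q.num : ℚ) := by
    exact_mod_cast congrArg (Int.cast : ℤ → ℚ) h1
  simp only [ratEnum, Nat.unpair_pair]
  rw [h2, h3, Rat.num_div_den]

theorem exists_codeEntry_eq (n : ℕ) (f : ℕ → ℕ) : ∃ k, ∀ i < n, codeEntry k i = f i := by
  induction n generalizing f with
  | zero => exact ⟨0, by simp⟩
  | succ n ih =>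
    obtain ⟨k, hk⟩ := ih fun i => f (i + 1)
    refine ⟨Nat.pair (f 0) k, fun i hi => ?_⟩
    cases i with
    | zero => simp [codeEntry]
    | succ i => simpa [codeEntry] using hk i (by omega)

theorem denseRange_ratPoint (n : ℕ) : DenseRange (ratPoint n) := by
  have h1 : DenseRange fun v : Fin n → ℚ => (fun i => ((v i : ℚ) : ℝ)) :=
    DenseRange.piMap (f := fun (_ : Fin n) (q : ℚ) => (q : ℝ)) fun _ => Rat.denseRange_cast
  have h2 : DenseRange fun v : Fin n → ℚ =>
      (WithLp.toLp 2 (fun i => ((v i : ℚ) : ℝ)) : EuclideanSpace ℝ (Fin n)) :=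
    (WithLp.toLp_surjective 2).denseRange.comp h1 (PiLp.continuous_toLp 2 _)
  refine h2.mono ?_
  rintro _ ⟨v, rfl⟩
  choose g hg using fun i => ratEnum_surjective (v i)
  obtain ⟨k, hk⟩ := exists_codeEntry_eq n fun i => if h : i < n then g ⟨i, h⟩ else 0
  refine ⟨k, ?_⟩
  simp only [ratPoint]
  congr 1
  funext i
  rw [hk i i.2]
  simp [hg]

/-- The Cauchy representation of `ℝⁿ`. -/
noncomputable def euclideanRep (n : ℕ) : BaireRep (EuclideanSpace ℝ (Fin n)) :=
  cauchyRep (ratPoint n) (denseRange_ratPoint n)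

/-- The positive information representation of the nonempty closed subsets of `ℝⁿ`. -/
noncomputable def euclideanClosedRep (n : ℕ) :
    BaireRep (NonemptyClosed (EuclideanSpace ℝ (Fin n))) :=
  positiveRep (ratPoint n) (denseRange_ratPoint n)

/-!
*Approximate projection reduces to `Sort`.* Fix a ratio `ρ < 1` with `(1 + ε) ρ ≥ 1` and levels
`v j = C ρ ^ j` starting above `d(x, A)`. From names of `x` and `A` one can semidecide
`d(x, A) < v j`, so one can write a binary sequence that contains a further zero whenever the next
level is seen to lie above `d(x, A)`. Sorting it decides all these tests: reading the sorted
sequence, one either finds the last level `v m` above `d(x, A)`, or sees zeros forever, which means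
that `d(x, A) = 0` and that `x` itself is a projection. As long as only zeros are seen, copy
approximations of `x`. Once `m` is known, continue with centres of small balls that meet `A` within
distance `v m` of `x`. Every point of `A` within distance `v m` of `x` is admissible, because
`v m = ρ⁻¹ * v (m + 1) ≤ (1 + ε) * d(x, A)`.

*`Sort` reduces to approximate projection.* Given `p`, let `A` be the closure of the set of those
`aᵢ` for which `p` contains at least `i` zeros, where `d(aᵢ, o) = b⁻ⁱ` and `b > 1 + ε`. An
approximate projection `y` of `o` onto `A` satisfies `d(y, o) ≤ b⁻⁽ʲ⁺¹⁾` if `p` contains more than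
`j` zeros, and `d(y, o) ≥ b⁻ʲ` otherwise. For `b ≥ 3` these cases are told apart by an approximation
of `y` with error less than `b⁻⁽ʲ⁺¹⁾`.
-/

/-! ### Machines on Baire space -/

section InitialWord

theorem initialWord_succ (p : ℕ → ℕ) (k : ℕ) :
    initialWord p (k + 1) = initialWord p k ++ [p k] := by
  rw [initialWord, List.ofFn_succ_last]
  rfl

@[simp] theorem length_initialWord (p : ℕ → ℕ) (k : ℕ) : (initialWord p k).length = k :=
  List.length_ofFn

@[simp] theorem getElem_initialWord (p : ℕ → ℕ) {i k : ℕ} (h : i < (initialWord p k).length) :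
    (initialWord p k)[i] = p i :=
  List.getElem_ofFn h

theorem getD_initialWord (p : ℕ → ℕ) {i k : ℕ} (h : i < k) : (initialWord p k).getD i 0 = p i := by
  rw [List.getD_eq_getElem _ _ (by simpa using h), getElem_initialWord]

theorem map_initialWord (f : ℕ → ℕ) (p : ℕ → ℕ) (k : ℕ) :
    (initialWord p k).map f = initialWord (fun i => f (p i)) k :=
  List.map_ofFn ..

theorem take_initialWord (p : ℕ → ℕ) {i k : ℕ} (h : i ≤ k) :
    (initialWord p k).take i = initialWord p i :=
  List.ext_getElem (by simpa using h) fun _ _ _ => by simp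

theorem initialWord_prefix_initialWord (p : ℕ → ℕ) {k l : ℕ} (h : k ≤ l) :
    initialWord p k <+: initialWord p l :=
  take_initialWord p h ▸ List.take_prefix k _

end InitialWord

/-- The partial function on Baire space approximated by a word function `h` that is monotone for
the prefix order: its value at `p` extends all the words `h (p(0) … p(k-1))`, and it is defined
when their lengths are unbounded. -/
noncomputable def wordLimit (h : List ℕ → List ℕ) : (ℕ → ℕ) →. (ℕ → ℕ) := fun p =>
  ⟨∀ m, ∃ k, m ≤ (h (initialWord p k)).length,
    fun hp i => (h (initialWord p (hp (i + 1)).choose)).getD i 0⟩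

section WordLimit

variable {h : List ℕ → List ℕ} (hmono : ∀ u v, u <+: v → h u <+: h v)

include hmono

theorem eq_initialWord_of_mem_wordLimit {p q : ℕ → ℕ} (hq : q ∈ wordLimit h p) (k : ℕ) :
    h (initialWord p k) = initialWord q (h (initialWord p k)).length := by
  obtain ⟨hp, rfl⟩ := hq
  refine List.ext_getElem (length_initialWord _ _).symm fun i hi _ => ?_
  have hi' : i < (h (initialWord p (hp (i + 1)).choose)).length := (hp (i + 1)).choose_spec
  rw [getElem_initialWord]
  change _ = List.getD _ i 0
  rw [List.getD_eq_getElem _ _ hi']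
  rcases le_total k (hp (i + 1)).choose with hk | hk
  · exact (hmono _ _ (initialWord_prefix_initialWord p hk)).getElem hi
  · exact ((hmono _ _ (initialWord_prefix_initialWord p hk)).getElem hi').symm

theorem typeTwoComputable_wordLimit (hh : Computable h) : TypeTwoComputable (wordLimit h) :=
  ⟨h, hh, hmono, fun _ _ hq => ⟨fun k => ⟨_, eq_initialWord_of_mem_wordLimit hmono hq k⟩, hq.1⟩⟩

end WordLimit

/-- The word written by the machine `ψ` on reading `w`: after each input symbol, `ψ` sees the input
read and the output written so far, and may append one output symbol. -/
def run (ψ : List ℕ → List ℕ → Option ℕ) (w : List ℕ) : List ℕ :=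
  (w.foldl (fun s a => (s.1 ++ [a], s.2 ++ (ψ (s.1 ++ [a]) s.2).toList))
    (([], []) : List ℕ × List ℕ)).2

/-- The partial function on Baire space computed by the machine `ψ`. -/
noncomputable def machineFun (ψ : List ℕ → List ℕ → Option ℕ) : (ℕ → ℕ) →. (ℕ → ℕ) :=
  wordLimit (run ψ)

section Machine

variable {ψ : List ℕ → List ℕ → Option ℕ}

theorem run_concat (w : List ℕ) (a : ℕ) :
    run ψ (w ++ [a]) = run ψ w ++ (ψ (w ++ [a]) (run ψ w)).toList := by
  have fst_foldl (w : List ℕ) :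
      (w.foldl (fun s a => (s.1 ++ [a], s.2 ++ (ψ (s.1 ++ [a]) s.2).toList))
        (([], []) : List ℕ × List ℕ)).1 = w := by
    induction w using List.reverseRecOn with
    | nil => rfl
    | append_singleton w a ih => rw [List.foldl_append, List.foldl_cons, List.foldl_nil, ih]
  simp only [run, List.foldl_append, List.foldl_cons, List.foldl_nil, fst_foldl]

theorem run_initialWord_succ (p : ℕ → ℕ) (k : ℕ) :
    run ψ (initialWord p (k + 1)) = run ψ (initialWord p k) ++
      (ψ (initialWord p (k + 1)) (run ψ (initialWord p k))).toList := by
  rw [initialWord_succ, run_concat]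

theorem run_prefix_run {u v : List ℕ} (h : u <+: v) : run ψ u <+: run ψ v := by
  obtain ⟨t, rfl⟩ := h
  induction t using List.reverseRecOn with
  | nil => rw [List.append_nil]
  | append_singleton t a ih =>
    rw [← List.append_assoc, run_concat]
    exact ih.trans (List.prefix_append _ _)

theorem primrec_run (hψ : Primrec₂ ψ) : Primrec (run ψ) := by
  have hw : Primrec fun x : List ℕ × (List ℕ × List ℕ) × ℕ => x.2.1.1 ++ [x.2.2] :=
    Primrec.list_concat.comp (Primrec.fst.comp (Primrec.fst.comp Primrec.snd))
      (Primrec.snd.comp Primrec.snd)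
  have hout : Primrec fun x : List ℕ × (List ℕ × List ℕ) × ℕ => x.2.1.2 :=
    Primrec.snd.comp (Primrec.fst.comp Primrec.snd)
  exact Primrec.snd.comp (Primrec.list_foldl Primrec.id (Primrec.const ([], []))
    (Primrec.pair hw (Primrec.list_append.comp hout
      (Primrec.optionToList.comp (hψ.comp hw hout)))).to₂)

theorem typeTwoComputable_machineFun (hψ : Primrec₂ ψ) : TypeTwoComputable (machineFun ψ) :=
  typeTwoComputable_wordLimit (fun _ _ => run_prefix_run) (primrec_run hψ).to_comp

theorem run_eq_of_forall_eq_none {p : ℕ → ℕ} {k l : ℕ} (hkl : k ≤ l)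
    (h : ∀ i, k ≤ i → i < l → ψ (initialWord p (i + 1)) (run ψ (initialWord p k)) = none) :
    run ψ (initialWord p l) = run ψ (initialWord p k) := by
  induction l, hkl using Nat.le_induction with
  | base => rfl
  | succ l hkl ih =>
    rw [run_initialWord_succ, ih fun i hki hil => h i hki (hil.trans l.lt_succ_self),
      h l hkl l.lt_succ_self, Option.toList_none, List.append_nil]

theorem exists_run_eq_and_isSome {p : ℕ → ℕ} {k : ℕ}
    (hlive : ∃ᶠ l in atTop, (ψ (initialWord p (l + 1)) (run ψ (initialWord p k))).isSome) :
    ∃ l, run ψ (initialWord p l) = run ψ (initialWord p k) ∧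
      (ψ (initialWord p (l + 1)) (run ψ (initialWord p l))).isSome := by
  classical
  have hex := frequently_atTop.1 hlive k
  obtain ⟨hkl, hl⟩ := Nat.find_spec hex
  have hrun := run_eq_of_forall_eq_none hkl fun i hki hi =>
    Option.not_isSome_iff_eq_none.1 fun hs => Nat.find_min hex hi ⟨hki, hs⟩
  exact ⟨_, hrun, by rwa [hrun]⟩

theorem exists_length_run_eq_and_isSome {p : ℕ → ℕ}
    (hlive : ∀ k, ∃ᶠ l in atTop, (ψ (initialWord p (l + 1)) (run ψ (initialWord p k))).isSome)
    (i : ℕ) : ∃ k, (run ψ (initialWord p k)).length = i ∧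
      (ψ (initialWord p (k + 1)) (run ψ (initialWord p k))).isSome := by
  induction i with
  | zero =>
    obtain ⟨k, hk, hsome⟩ := exists_run_eq_and_isSome (hlive 0)
    exact ⟨k, by rw [hk]; rfl, hsome⟩
  | succ i ih =>
    obtain ⟨k, hk, hsome⟩ := ih
    obtain ⟨a, ha⟩ := Option.isSome_iff_exists.1 hsome
    obtain ⟨l, hl, hsome'⟩ := exists_run_eq_and_isSome (hlive (k + 1))
    exact ⟨l, by rw [hl, run_initialWord_succ, ha]; simp [hk], hsome'⟩

theorem exists_mem_machineFun {p : ℕ → ℕ} (Inv : List ℕ → Prop) (hnil : Inv [])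
    (hconcat : ∀ k out a, Inv out → ψ (initialWord p (k + 1)) out = some a → Inv (out ++ [a]))
    (hlive : ∀ out, Inv out → ∃ᶠ k in atTop, (ψ (initialWord p (k + 1)) out).isSome) :
    ∃ q ∈ machineFun ψ p, ∀ i, Inv (initialWord q i) ∧
      ∃ k, ψ (initialWord p (k + 1)) (initialWord q i) = some (q i) := by
  have hInv (k : ℕ) : Inv (run ψ (initialWord p k)) := by
    induction k with
    | zero => exact hnil
    | succ k ih =>
      rw [run_initialWord_succ]
      cases hout : ψ (initialWord p (k + 1)) (run ψ (initialWord p k)) with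
      | none => simpa using ih
      | some a => exact hconcat k _ a ih hout
  have hstage := exists_length_run_eq_and_isSome fun k => hlive _ (hInv k)
  obtain ⟨q, hq⟩ : ∃ q, q ∈ machineFun ψ p :=
    ⟨_, fun m => (hstage m).imp fun _ hk => hk.1.ge, rfl⟩
  have hrun := eq_initialWord_of_mem_wordLimit (fun _ _ => run_prefix_run) hq
  refine ⟨q, hq, fun i => ?_⟩
  obtain ⟨k, hk, hsome⟩ := hstage i
  obtain ⟨a, ha⟩ := Option.isSome_iff_exists.1 hsome
  have hki : run ψ (initialWord p k) = initialWord q i := hk ▸ hrun k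
  have hki' : initialWord q i ++ [a] = initialWord q (i + 1) := by
    have := hrun (k + 1)
    rwa [run_initialWord_succ, ha, hki, Option.toList_some, List.length_append,
      length_initialWord, List.length_singleton] at this
  rw [initialWord_succ, List.append_cancel_left_eq, List.singleton_inj] at hki'
  exact ⟨hki ▸ hInv k, k, by rw [← hki, ha, hki']⟩

end Machine

/-- The machine that writes its `i`-th symbol `g (p(0) … p(f i - 1)) (q(0) … q(i-1))` as soon as the
input symbols it depends on have been read. -/
def waitStep (f : ℕ → ℕ) (g : List ℕ → List ℕ → ℕ) (w out : List ℕ) : Option ℕ :=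
  if f out.length ≤ w.length then some (g (w.take (f out.length)) out) else none

theorem primrec_waitStep {f : ℕ → ℕ} {g : List ℕ → List ℕ → ℕ} (hf : Primrec f)
    (hg : Primrec₂ g) : Primrec₂ (waitStep f g) :=
  have hlen : Primrec fun x : List ℕ × List ℕ => f x.2.length :=
    hf.comp (Primrec.list_length.comp Primrec.snd)
  Primrec.ite (Primrec.nat_le.comp hlen (Primrec.list_length.comp Primrec.fst))
    (Primrec.option_some.comp (hg.comp (Primrec.list_take.comp hlen Primrec.fst) Primrec.snd))
    (Primrec.const none)

theorem exists_typeTwoComputable_rec {f : ℕ → ℕ} {g : List ℕ → List ℕ → ℕ} (hf : Primrec f)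
    (hg : Primrec₂ g) : ∃ F, TypeTwoComputable F ∧
      ∀ p, ∃ q ∈ F p, ∀ i, q i = g (initialWord p (f i)) (initialWord q i) := by
  refine ⟨_, typeTwoComputable_machineFun (primrec_waitStep hf hg), fun p => ?_⟩
  obtain ⟨q, hq, hstep⟩ := exists_mem_machineFun (ψ := waitStep f g) (p := p) (fun _ => True)
    trivial (fun _ _ _ _ _ => trivial) fun out _ => by
      refine Eventually.frequently ?_
      filter_upwards [eventually_ge_atTop (f out.length)] with k hk
      rw [waitStep, if_pos (by rw [length_initialWord]; omega), Option.isSome_some]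
  refine ⟨q, hq, fun i => ?_⟩
  obtain ⟨-, k, hk⟩ := hstep i
  simp only [waitStep, length_initialWord, Option.ite_none_right_eq_some, Option.some_inj] at hk
  rw [← hk.2, take_initialWord p hk.1]

/-- The word of first components of a word of pairs. -/
def pairFst (w : List ℕ) : List ℕ := w.map fun a => a.unpair.1

/-- The word of second components of a word of pairs. -/
def pairSnd (w : List ℕ) : List ℕ := w.map fun a => a.unpair.2

@[simp] theorem pairFst_initialWord (p q : ℕ → ℕ) (k : ℕ) :
    pairFst (initialWord (pairName p q) k) = initialWord p k := by
  simp [pairFst, map_initialWord, pairName]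

@[simp] theorem pairSnd_initialWord (p q : ℕ → ℕ) (k : ℕ) :
    pairSnd (initialWord (pairName p q) k) = initialWord q k := by
  simp [pairSnd, map_initialWord, pairName]

theorem primrec_pairFst : Primrec pairFst :=
  Primrec.list_map Primrec.id (Primrec.fst.comp (Primrec.unpair.comp Primrec.snd)).to₂

theorem primrec_pairSnd : Primrec pairSnd :=
  Primrec.list_map Primrec.id (Primrec.snd.comp (Primrec.unpair.comp Primrec.snd)).to₂

/-! ### Primitive recursive rational-valued functions -/

theorem primrec_pow : Primrec₂ fun b e : ℕ => b ^ e :=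
  Primrec₂.unpaired'.1 Nat.Primrec.pow

/-- A rational-valued function is primitive recursive if it has the form `(a - b) / (c + 1)` with
`a`, `b`, `c` primitive recursive and natural-valued, as in `ratEnum`. -/
def PrimrecRat {σ : Type*} [Primcodable σ] (f : σ → ℚ) : Prop :=
  ∃ a b c : σ → ℕ, Primrec a ∧ Primrec b ∧ Primrec c ∧
    ∀ x, f x = ((a x : ℚ) - b x) / ((c x : ℚ) + 1)

namespace PrimrecRat

variable {σ τ : Type*} [Primcodable σ] [Primcodable τ] {f g : σ → ℚ}

theorem exists_code (hf : PrimrecRat f) : ∃ e : σ → ℕ, Primrec e ∧ ∀ x, f x = ratEnum (e x) := by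
  obtain ⟨a, b, c, ha, hb, hc, h⟩ := hf
  exact ⟨fun x => Nat.pair (Nat.pair (a x) (b x)) (c x),
    Primrec₂.natPair.comp (Primrec₂.natPair.comp ha hb) hc, fun x => by simp [_root_.ratEnum, h]⟩

theorem exists_le_natCast (hf : PrimrecRat f) : ∃ a : σ → ℕ, Primrec a ∧ ∀ x, f x ≤ a x := by
  obtain ⟨a, b, c, ha, -, -, h⟩ := hf
  refine ⟨a, ha, fun x => ?_⟩
  rw [h, div_le_iff₀ (by positivity)]
  have : (0 : ℚ) ≤ b x + a x * c x := by positivity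
  linarith

theorem comp {f : τ → ℚ} (hf : PrimrecRat f) {e : σ → τ} (he : Primrec e) :
    PrimrecRat fun x => f (e x) := by
  obtain ⟨a, b, c, ha, hb, hc, h⟩ := hf
  exact ⟨_, _, _, ha.comp he, hb.comp he, hc.comp he, fun x => h (e x)⟩

theorem const (q : ℚ) : PrimrecRat fun _ : σ => q := by
  obtain ⟨k, hk⟩ := ratEnum_surjective q
  exact ⟨_, _, _, Primrec.const _, Primrec.const _, Primrec.const _, fun _ => hk.symm⟩

theorem natCast {e : σ → ℕ} (he : Primrec e) : PrimrecRat fun x => (e x : ℚ) :=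
  ⟨e, _, _, he, Primrec.const 0, Primrec.const 0, fun _ => by simp⟩

theorem ratEnum : PrimrecRat ratEnum :=
  have h := Primrec.unpair.comp (Primrec.fst.comp Primrec.unpair)
  ⟨_, _, _, Primrec.fst.comp h, Primrec.snd.comp h, Primrec.snd.comp Primrec.unpair, fun _ => rfl⟩

theorem nonnegRatEnum : PrimrecRat nonnegRatEnum :=
  ⟨_, _, _, Primrec.fst.comp Primrec.unpair, Primrec.const 0, Primrec.snd.comp Primrec.unpair,
    fun _ => by simp [_root_.nonnegRatEnum]⟩

theorem neg (hf : PrimrecRat f) : PrimrecRat fun x => -f x := by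
  obtain ⟨a, b, c, ha, hb, hc, h⟩ := hf
  exact ⟨b, a, c, hb, ha, hc, fun x => by simp only [h, ← neg_div, neg_sub]⟩

theorem primrec_commonDenom {c d : σ → ℕ} (hc : Primrec c) (hd : Primrec d) :
    Primrec fun x => c x * (d x + 1) + d x :=
  Primrec.nat_add.comp (Primrec.nat_mul.comp hc (Primrec.succ.comp hd)) hd

theorem cast_commonDenom_add_one (c d : ℕ) :
    ((c * (d + 1) + d : ℕ) : ℚ) + 1 = (c + 1) * (d + 1) := by
  push_cast
  ring

theorem add (hf : PrimrecRat f) (hg : PrimrecRat g) : PrimrecRat fun x => f x + g x := by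
  obtain ⟨a, b, c, ha, hb, hc, h⟩ := hf
  obtain ⟨a', b', c', ha', hb', hc', h'⟩ := hg
  have hs := Primrec.succ.comp hc
  have hs' := Primrec.succ.comp hc'
  refine ⟨_, _, _,
    Primrec.nat_add.comp (Primrec.nat_mul.comp ha hs') (Primrec.nat_mul.comp ha' hs),
    Primrec.nat_add.comp (Primrec.nat_mul.comp hb hs') (Primrec.nat_mul.comp hb' hs),
    primrec_commonDenom hc hc', fun x => ?_⟩
  have hpos : (c x : ℚ) + 1 ≠ 0 := by positivity
  have hpos' : (c' x : ℚ) + 1 ≠ 0 := by positivity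
  simp only [h, h', cast_commonDenom_add_one]
  push_cast
  field_simp
  ring

theorem mul (hf : PrimrecRat f) (hg : PrimrecRat g) : PrimrecRat fun x => f x * g x := by
  obtain ⟨a, b, c, ha, hb, hc, h⟩ := hf
  obtain ⟨a', b', c', ha', hb', hc', h'⟩ := hg
  refine ⟨_, _, _,
    Primrec.nat_add.comp (Primrec.nat_mul.comp ha ha') (Primrec.nat_mul.comp hb hb'),
    Primrec.nat_add.comp (Primrec.nat_mul.comp ha hb') (Primrec.nat_mul.comp hb ha'),
    primrec_commonDenom hc hc', fun x => ?_⟩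
  simp only [h, h', cast_commonDenom_add_one, div_mul_div_comm]
  push_cast
  ring

theorem sub (hf : PrimrecRat f) (hg : PrimrecRat g) : PrimrecRat fun x => f x - g x := by
  simpa only [sub_eq_add_neg] using hf.add hg.neg

theorem sq (hf : PrimrecRat f) : PrimrecRat fun x => f x ^ 2 := by
  simpa only [_root_.sq] using hf.mul hf

theorem pow {r : ℚ} (hr : 0 ≤ r) {e : σ → ℕ} (he : Primrec e) :
    PrimrecRat fun x => r ^ e x := by
  have hpow (d : ℕ) : Primrec fun x => d ^ e x := primrec_pow.comp (Primrec.const d) he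
  refine ⟨_, _, _, hpow r.num.toNat, Primrec.const 0,
    Primrec.nat_sub.comp (hpow r.den) (Primrec.const 1), fun x => ?_⟩
  have hden : ((r.den ^ e x - 1 : ℕ) : ℚ) + 1 = (r.den : ℚ) ^ e x := by
    exact_mod_cast Nat.sub_add_cancel (Nat.one_le_pow _ _ r.pos)
  have hnum : ((r.num.toNat : ℕ) : ℚ) = (r.num : ℚ) := by
    exact_mod_cast congrArg (Int.cast : ℤ → ℚ) (Int.toNat_of_nonneg (Rat.num_nonneg.2 hr))
  rw [hden, Nat.cast_pow, hnum, Nat.cast_zero, sub_zero, ← div_pow, Rat.num_div_den]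

theorem lt (hf : PrimrecRat f) (hg : PrimrecRat g) : PrimrecPred fun x => f x < g x := by
  obtain ⟨a, b, c, ha, hb, hc, h⟩ := hf
  obtain ⟨a', b', c', ha', hb', hc', h'⟩ := hg
  have hs := Primrec.succ.comp hc
  have hs' := Primrec.succ.comp hc'
  refine (Primrec.nat_lt.comp
    (Primrec.nat_add.comp (Primrec.nat_mul.comp ha hs') (Primrec.nat_mul.comp hb' hs))
    (Primrec.nat_add.comp (Primrec.nat_mul.comp ha' hs) (Primrec.nat_mul.comp hb hs'))).of_eq
    fun x => ?_
  rw [h, h', div_lt_div_iff₀ (by positivity) (by positivity), ← Nat.cast_lt (α := ℚ)]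
  push_cast
  constructor <;> intro h <;> linarith

end PrimrecRat

/-- The distances between the points of the sequence `α` are primitive recursive: strict upper
bounds can be decided, and some natural upper bound can be found. -/
structure PrimrecMetric {X : Type*} [PseudoMetricSpace X] (α : ℕ → X) : Prop where
  dist_lt : PrimrecPred fun z : (ℕ × ℕ) × ℕ => dist (α z.1.1) (α z.1.2) < ratEnum z.2
  exists_bound : ∃ B : ℕ → ℕ → ℕ, Primrec₂ B ∧ ∀ k l, dist (α k) (α l) ≤ B k l

theorem PrimrecMetric.primrecPred_dist_lt {X σ : Type*} [PseudoMetricSpace X] [Primcodable σ]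
    {α : ℕ → X} (hα : PrimrecMetric α) {k l : σ → ℕ} {v : σ → ℚ} (hk : Primrec k) (hl : Primrec l)
    (hv : PrimrecRat v) : PrimrecPred fun x => dist (α (k x)) (α (l x)) < v x := by
  obtain ⟨e, he, hve⟩ := hv.exists_code
  exact (hα.dist_lt.comp ((hk.pair hl).pair he)).of_eq fun x => by rw [hve]

section RatPoint

/-- The squared Euclidean distance between `ratPoint n k` and `ratPoint n l`. -/
def sqDist (n k l : ℕ) : ℚ :=
  ∑ i ∈ Finset.range n, (ratEnum (codeEntry k i) - ratEnum (codeEntry l i)) ^ 2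

theorem sqDist_nonneg (n k l : ℕ) : 0 ≤ sqDist n k l :=
  Finset.sum_nonneg fun _ _ => sq_nonneg _

theorem dist_ratPoint (n k l : ℕ) :
    dist (ratPoint n k) (ratPoint n l) = √(sqDist n k l : ℝ) := by
  rw [EuclideanSpace.dist_eq, sqDist, Finset.sum_range]
  push_cast
  simp only [ratPoint, Real.dist_eq, sq_abs]

theorem dist_ratPoint_lt_iff {n k l : ℕ} {v : ℚ} :
    dist (ratPoint n k) (ratPoint n l) < v ↔ 0 < v ∧ sqDist n k l < v ^ 2 := by
  rw [dist_ratPoint]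
  constructor
  · intro h
    have hv : (0 : ℝ) < v := (Real.sqrt_nonneg _).trans_lt h
    rw [Real.sqrt_lt' hv] at h
    exact ⟨by exact_mod_cast hv, by exact_mod_cast h⟩
  · rintro ⟨hv, h⟩
    rw [Real.sqrt_lt' (by exact_mod_cast hv)]
    exact_mod_cast h

theorem dist_ratPoint_le (n k l : ℕ) :
    dist (ratPoint n k) (ratPoint n l) ≤ 1 + (sqDist n k l : ℝ) := by
  have h : (0 : ℝ) ≤ sqDist n k l := by exact_mod_cast sqDist_nonneg n k l
  rw [dist_ratPoint, Real.sqrt_le_left (by linarith)]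
  nlinarith

theorem primrec_codeEntry (i : ℕ) : Primrec fun k => codeEntry k i :=
  Primrec.fst.comp (Primrec.unpair.comp (Primrec.nat_iterate (Primrec.const i) Primrec.id
    (Primrec.snd.comp (Primrec.unpair.comp Primrec.snd)).to₂))

theorem primrecRat_sqDist (n : ℕ) : PrimrecRat fun z : ℕ × ℕ => sqDist n z.1 z.2 := by
  simp only [sqDist]
  induction n with
  | zero => simpa only [Finset.sum_range_zero] using PrimrecRat.const 0
  | succ n ih =>
    simp only [Finset.sum_range_succ]
    exact ih.add ((PrimrecRat.ratEnum.comp ((primrec_codeEntry n).comp Primrec.fst)).sub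
      (PrimrecRat.ratEnum.comp ((primrec_codeEntry n).comp Primrec.snd))).sq

theorem primrecMetric_ratPoint (n : ℕ) : PrimrecMetric (ratPoint n) where
  dist_lt :=
    have hv : PrimrecRat fun z : (ℕ × ℕ) × ℕ => ratEnum z.2 := PrimrecRat.ratEnum.comp Primrec.snd
    (((PrimrecRat.const 0).lt hv).and
      (((primrecRat_sqDist n).comp Primrec.fst).lt hv.sq)).of_eq fun _ => dist_ratPoint_lt_iff.symm
  exists_bound := by
    obtain ⟨a, ha, hle⟩ := (primrecRat_sqDist n).exists_le_natCast
    refine ⟨fun k l => 1 + a (k, l), Primrec.nat_add.comp (Primrec.const 1) ha, fun k l => ?_⟩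
    have h : (sqDist n k l : ℝ) ≤ a (k, l) := by exact_mod_cast hle (k, l)
    push_cast
    linarith [dist_ratPoint_le n k l]

end RatPoint

/-! ### Counting and sorting -/

theorem primrec_list_count {σ : Type*} [Primcodable σ] [DecidableEq σ] (a : σ) :
    Primrec fun w : List σ => w.count a :=
  (Primrec.list_length.comp (Primrec.listFilter (Primrec.eq.comp Primrec.id
    (Primrec.const a)))).of_eq fun w => by
      rw [List.count, List.countP_eq_length_filter]
      congr

theorem count_zero_initialWord (p : ℕ → ℕ) (k : ℕ) :
    (initialWord p k).count 0 = Nat.count (fun i => p i = 0) k := by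
  induction k with
  | zero => rfl
  | succ k ih => simp [initialWord_succ, Nat.count_succ, ih, List.count_singleton]

theorem exists_lt_count_iff_forall_finite {c : ℕ → Prop} [DecidablePred c] {j : ℕ} :
    (∃ k, j < Nat.count c k) ↔ ∀ hc : {i | c i}.Finite, j < hc.toFinset.card := by
  refine ⟨fun ⟨k, hk⟩ hc => hk.trans_le ?_,
    fun h => ⟨_, by rw [Nat.count_nth_succ h]; exact Nat.lt_succ_self j⟩⟩
  rw [Nat.count_eq_card_filter_range]
  exact Finset.card_le_card fun i hi => by simpa using (Finset.mem_filter.1 hi).2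

theorem exists_lt_count_iff_of_greedy {c : ℕ → Prop} [DecidablePred c] {P : ℕ → ℕ → Prop}
    {Q : ℕ → Prop} (hc : ∀ k, c k ↔ P (Nat.count c k) k) (hQ : ∀ i j, i ≤ j → Q j → Q i)
    (hPQ : ∀ j k, P j k → Q j) (hQP : ∀ j, Q j → ∃ᶠ k in atTop, P j k) (j : ℕ) :
    (∃ k, j < Nat.count c k) ↔ Q j := by
  constructor
  · rintro ⟨k, hk⟩
    induction k with
    | zero => exact absurd hk (by simp)
    | succ k ih =>
      by_cases hjk : j < Nat.count c k
      · exact ih hjk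
      · have hck : c k := by
          by_contra hck
          exact hjk (by rwa [Nat.count_succ, if_neg hck] at hk)
        rw [Nat.count_succ, if_pos hck] at hk
        obtain rfl : j = Nat.count c k := by omega
        exact hPQ _ k ((hc k).1 hck)
  · have lt_count_of_le {j k : ℕ} (hjk : j ≤ Nat.count c k) (hj : Q j) :
        ∃ l, j < Nat.count c l := by
      obtain ⟨l, hkl, hl⟩ := frequently_atTop.1 (hQP j hj) k
      rcases (hjk.trans (Nat.count_monotone c hkl)).lt_or_eq with h | rfl
      · exact ⟨l, h⟩
      · exact ⟨l + 1, by rw [Nat.count_succ, if_pos ((hc l).2 hl)]; exact Nat.lt_succ_self _⟩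
    intro hj
    induction j with
    | zero => exact lt_count_of_le (k := 0) (Nat.zero_le _) hj
    | succ j ih =>
      obtain ⟨k, hk⟩ := ih (hQ _ _ (Nat.le_succ j) hj)
      exact lt_count_of_le hk hj

theorem apply_eq_zero_iff_of_cantorRep {p : ℕ → ℕ} {x : ℕ → Fin 2} (hp : cantorRep.IsName p x)
    (i : ℕ) : p i = 0 ↔ x i = 0 := by
  rw [hp i, Fin.ext_iff, Fin.val_zero]

theorem sortFun_eq_zero_iff {p : ℕ → ℕ} {x : ℕ → Fin 2} (hp : cantorRep.IsName p x) (j : ℕ) :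
    sortFun x j = 0 ↔ ∃ k, j < Nat.count (fun i => p i = 0) k := by
  rw [exists_lt_count_iff_forall_finite]
  simp only [apply_eq_zero_iff_of_cantorRep hp, sortFun]
  split_ifs with hx
  · rw [Set.ncard_eq_toFinset_card _ hx]
    simp [hx]
  · simp [hx]

/-! ### Names in metric spaces -/

section Metric

variable {X : Type*} [MetricSpace X] {α : ℕ → X} {hα : DenseRange α}

theorem nonnegRatEnum_nonneg (m : ℕ) : 0 ≤ nonnegRatEnum m := by
  unfold nonnegRatEnum
  positivity

theorem tendsto_half_pow : Tendsto (fun i : ℕ => (1 / 2 : ℝ) ^ i) atTop (𝓝 0) :=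
  tendsto_pow_atTop_nhds_zero_of_lt_one (by norm_num) (by norm_num)

theorem half_pow_anti {i j : ℕ} (h : i ≤ j) : (1 / 2 : ℝ) ^ j ≤ (1 / 2) ^ i :=
  pow_le_pow_of_le_one (by norm_num) (by norm_num) h

theorem isOpen_basicBall (α : ℕ → X) (k : ℕ) : IsOpen (basicBall α k) :=
  isOpen_ball

theorem exists_mem_basicBall_radius_lt (hα : DenseRange α) (x : X) {r : ℝ} (hr : 0 < r) :
    ∃ k, x ∈ basicBall α k ∧ (nonnegRatEnum k.unpair.2 : ℝ) < r := by
  obtain ⟨n, hn⟩ := hα.exists_dist_lt x hr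
  obtain ⟨q, hxq, hqr⟩ := exists_rat_btwn hn
  obtain ⟨m, hm⟩ := exists_nonnegRatEnum_eq (q := q) (by exact_mod_cast dist_nonneg.trans hxq.le)
  exact ⟨Nat.pair n m, by simpa [basicBall, hm] using hxq, by simpa [hm] using hqr⟩

theorem approxProj_nonempty {ε : ℝ} (hε : 0 < ε) (z : X × NonemptyClosed X) :
    (approxProj ε z).Nonempty := by
  obtain ⟨x, A, hA, hne⟩ := z
  rcases infDist_nonneg.eq_or_lt' (a := infDist x A) with h | h
  · exact ⟨x, (hA.mem_iff_infDist_zero hne).2 h, by simp [h]⟩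
  · obtain ⟨y, hyA, hy⟩ := (infDist_lt_iff hne).1 (lt_mul_left h (lt_add_of_pos_right 1 hε))
    exact ⟨y, hyA, hy.le⟩

theorem cauchyRep_isName_const (k : ℕ) : (cauchyRep α hα).IsName (fun _ => k) (α k) :=
  ⟨fun _ _ _ => by simp, tendsto_const_nhds⟩

theorem dist_le_of_cauchyRep {p : ℕ → ℕ} {x : X} (h : (cauchyRep α hα).IsName p x) (i : ℕ) :
    dist (α (p i)) x ≤ (1 / 2) ^ i :=
  le_of_tendsto (tendsto_const_nhds.dist h.2) (eventually_atTop.2 ⟨i, fun j hj => h.1 i j hj⟩)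

theorem cauchyRep_isName_shift {p : ℕ → ℕ} {x : X} (h : (cauchyRep α hα).IsName p x) (c : ℕ) :
    (cauchyRep α hα).IsName (fun i => p (i + c)) x :=
  ⟨fun i _ hij =>
    (h.1 _ _ (Nat.add_le_add_right hij c)).trans (half_pow_anti (Nat.le_add_right i c)),
    (tendsto_add_atTop_iff_nat c).2 h.2⟩

theorem exists_cauchyRep_isName_of_dist_succ_le [CompleteSpace X] {q : ℕ → ℕ}
    (h : ∀ i, dist (α (q i)) (α (q (i + 1))) ≤ (1 / 2) ^ (i + 1)) :
    ∃ y, (cauchyRep α hα).IsName q y := by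
  have hle (i j : ℕ) (hij : i ≤ j) :
      dist (α (q i)) (α (q j)) ≤ (1 / 2 : ℝ) ^ i - (1 / 2) ^ j := by
    induction j, hij using Nat.le_induction with
    | base => simp
    | succ j _ ih =>
      have htri := dist_triangle (α (q i)) (α (q j)) (α (q (j + 1)))
      have hpow : (1 / 2 : ℝ) ^ j = 2 * (1 / 2) ^ (j + 1) := by ring
      linarith [h j]
  have hcauchy : CauchySeq fun i => α (q i) :=
    cauchySeq_of_le_geometric_two (C := 1) fun i => (h i).trans (le_of_eq (by
      rw [pow_succ, one_div_pow]; ring))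
  obtain ⟨y, hy⟩ := cauchySeq_tendsto_of_complete hcauchy
  exact ⟨y, fun i j hij => (hle i j hij).trans (sub_le_self _ (by positivity)), hy⟩

end Metric

/-! ### Reducing sorting to approximate projection -/

section SortToProj

variable {X : Type*} [MetricSpace X] {α : ℕ → X} {hα : DenseRange α} {e : ℕ → ℕ} {p : ℕ → ℕ}

variable (α e p) in
/-- The closure of the set of all points `α (e i)` for which `p` contains at least `i` zeros. It is
the set onto which the reduction of `Sort` projects. -/
def zeroCountClosed : NonemptyClosed X :=
  ⟨closure {y | ∃ i k, i ≤ Nat.count (fun j => p j = 0) k ∧ α (e i) = y}, isClosed_closure,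
    ⟨α (e 0), subset_closure ⟨0, 0, Nat.zero_le _, rfl⟩⟩⟩

theorem mem_zeroCountClosed {i k : ℕ} (h : i ≤ Nat.count (fun j => p j = 0) k) :
    α (e i) ∈ (zeroCountClosed α e p).1 :=
  subset_closure ⟨i, k, h, rfl⟩

theorem zeroCountClosed_subset {C : Set X} (hC : IsClosed C)
    (h : ∀ i k, i ≤ Nat.count (fun j => p j = 0) k → α (e i) ∈ C) :
    (zeroCountClosed α e p).1 ⊆ C :=
  closure_minimal (by rintro _ ⟨i, k, hik, rfl⟩; exact h i k hik) hC

theorem inter_zeroCountClosed_nonempty_iff {U : Set X} (hU : IsOpen U) :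
    (U ∩ (zeroCountClosed α e p).1).Nonempty ↔
      ∃ i k, i ≤ Nat.count (fun j => p j = 0) k ∧ α (e i) ∈ U := by
  rw [Set.inter_comm, zeroCountClosed, closure_inter_open_nonempty_iff hU]
  constructor
  · rintro ⟨_, ⟨i, k, hik, rfl⟩, hiU⟩
    exact ⟨i, k, hik, hiU⟩
  · rintro ⟨i, k, hik, hiU⟩
    exact ⟨_, ⟨i, k, hik, rfl⟩, hiU⟩

open Classical in
variable (α e) in
/-- The index of a ball that is seen to meet `zeroCountClosed α e p` after reading the word `w` of
`p`. The length `⟨c, ⟨i, k⟩⟩` of `w` asks whether the ball `c` contains `α (e i)`; otherwise the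
unit ball about `α (e 0)` is taken. -/
noncomputable def meetingBall (w : List ℕ) : ℕ :=
  if w.length.unpair.2.unpair.1 ≤ w.count 0 ∧
      α (e w.length.unpair.2.unpair.1) ∈ basicBall α w.length.unpair.1
    then w.length.unpair.1 else Nat.pair (e 0) (Nat.pair 1 0)

theorem primrec_meetingBall (hprim : PrimrecMetric α) (he : Primrec e) :
    Primrec (meetingBall α e) := by
  classical
  have hlen : Primrec fun w : List ℕ => w.length.unpair :=
    Primrec.unpair.comp Primrec.list_length
  have hc := Primrec.fst.comp hlen
  have hball := Primrec.unpair.comp hc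
  have hi := Primrec.fst.comp (Primrec.unpair.comp (Primrec.snd.comp hlen))
  exact Primrec.ite ((Primrec.nat_le.comp hi (primrec_list_count 0)).and
    (hprim.primrecPred_dist_lt (he.comp hi) (Primrec.fst.comp hball)
      (PrimrecRat.nonnegRatEnum.comp (Primrec.snd.comp hball)))) hc (Primrec.const _)

theorem positiveRep_isName_meetingBall :
    (positiveRep α hα).IsName (fun k => meetingBall α e (initialWord p k))
      (zeroCountClosed α e p) := by
  intro c
  rw [inter_zeroCountClosed_nonempty_iff (isOpen_basicBall α c)]
  constructor
  · rintro ⟨t, rfl⟩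
    beta_reduce
    rw [meetingBall, count_zero_initialWord]
    split_ifs with h
    · exact ⟨_, _, h⟩
    · exact ⟨0, 0, Nat.zero_le _, by simp [basicBall, nonnegRatEnum]⟩
  · rintro ⟨i, k, hik, hc⟩
    have hk : k ≤ Nat.pair c (Nat.pair i k) :=
      (Nat.right_le_pair i k).trans (Nat.right_le_pair c _)
    refine ⟨Nat.pair c (Nat.pair i k), ?_⟩
    beta_reduce
    rw [meetingBall, length_initialWord, count_zero_initialWord, if_pos]
    · simp only [Nat.unpair_pair]
    · simp only [Nat.unpair_pair]
      exact ⟨hik.trans (Nat.count_monotone _ hk), hc⟩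

theorem exists_typeTwoComputable_zeroCountClosed (hprim : PrimrecMetric α) (he : Primrec e)
    (o : ℕ) : ∃ K, TypeTwoComputable K ∧ ∀ p, ∃ r ∈ K p,
      ((cauchyRep α hα).prod (positiveRep α hα)).IsName r (α o, zeroCountClosed α e p) := by
  obtain ⟨K, hK, hKr⟩ := exists_typeTwoComputable_rec (f := id)
    (g := fun w _ => Nat.pair o (meetingBall α e w)) Primrec.id
    (Primrec₂.natPair.comp (Primrec.const o) ((primrec_meetingBall hprim he).comp Primrec.fst)).to₂
  refine ⟨K, hK, fun p => ?_⟩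
  obtain ⟨r, hr, hrp⟩ := hKr p
  exact ⟨r, hr, fun _ => o, _, funext hrp, cauchyRep_isName_const o, positiveRep_isName_meetingBall⟩

section Gap

variable {o b : ℕ} (hdist : ∀ i, dist (α (e i)) (α o) = (1 / b : ℝ) ^ i) (hb : 0 < b)

include hb in
theorem one_div_natCast_pow_anti {i j : ℕ} (h : i ≤ j) : (1 / b : ℝ) ^ j ≤ (1 / b) ^ i :=
  pow_le_pow_of_le_one (by positivity)
    (div_le_one_of_le₀ (by exact_mod_cast hb) (by positivity)) h

include hb in
theorem one_div_natCast_pow_eq (j : ℕ) : (1 / b : ℝ) ^ j = b * (1 / b) ^ (j + 1) := by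
  have : (b : ℝ) ≠ 0 := by exact_mod_cast hb.ne'
  rw [pow_succ]
  field_simp

include hdist hb

theorem one_div_pow_le_dist_of_forall_count_le {y : X} {j : ℕ}
    (hy : y ∈ (zeroCountClosed α e p).1) (hj : ∀ k, Nat.count (fun i => p i = 0) k ≤ j) :
    (1 / b : ℝ) ^ j ≤ dist y (α o) := by
  refine zeroCountClosed_subset (C := {y | (1 / b : ℝ) ^ j ≤ dist y (α o)})
    (isClosed_le continuous_const (continuous_id.dist continuous_const)) (fun i k hik => ?_) hy
  exact (one_div_natCast_pow_anti hb (hik.trans (hj k))).trans (hdist i).ge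

theorem dist_le_or_le_dist_of_mem_zeroCountClosed {y : X}
    (hy : y ∈ (zeroCountClosed α e p).1) (j : ℕ) :
    dist y (α o) ≤ (1 / b : ℝ) ^ (j + 1) ∨ (1 / b : ℝ) ^ j ≤ dist y (α o) := by
  have hcont : Continuous fun y => dist y (α o) := continuous_id.dist continuous_const
  refine zeroCountClosed_subset (C := {y | dist y (α o) ≤ (1 / b : ℝ) ^ (j + 1)} ∪
    {y | (1 / b : ℝ) ^ j ≤ dist y (α o)}) ((isClosed_le hcont continuous_const).union
      (isClosed_le continuous_const hcont)) (fun i k _ => ?_) hy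
  rcases Nat.lt_or_ge j i with hij | hij
  · exact Or.inl ((hdist i).trans_le (one_div_natCast_pow_anti hb hij))
  · exact Or.inr ((one_div_natCast_pow_anti hb hij).trans (hdist i).ge)

theorem dist_le_of_lt_count {ε : ℝ} (hε : 0 < ε) (hbε : 1 + ε < b) {y : X}
    (hy : y ∈ approxProj ε (α o, zeroCountClosed α e p)) {j k : ℕ}
    (hj : j < Nat.count (fun i => p i = 0) k) : dist y (α o) ≤ (1 / b : ℝ) ^ (j + 1) := by
  obtain ⟨hyA, hyd⟩ := hy
  refine (dist_le_or_le_dist_of_mem_zeroCountClosed hdist hb hyA j).resolve_right fun hfar => ?_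
  have hpos : (0 : ℝ) < (1 / b) ^ (j + 1) :=
    pow_pos (one_div_pos.2 (by exact_mod_cast hb)) _
  have hinf : infDist (α o) (zeroCountClosed α e p).1 ≤ (1 / b : ℝ) ^ (j + 1) := by
    rw [← hdist, dist_comm]
    exact infDist_le_dist_of_mem (mem_zeroCountClosed hj)
  have hcontra : b * (1 / b : ℝ) ^ (j + 1) < b * (1 / b : ℝ) ^ (j + 1) := calc
    b * (1 / b : ℝ) ^ (j + 1) = (1 / b) ^ j := (one_div_natCast_pow_eq hb j).symm
    _ ≤ dist (α o) y := by rwa [dist_comm]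
    _ ≤ (1 + ε) * infDist (α o) (zeroCountClosed α e p).1 := hyd
    _ ≤ (1 + ε) * (1 / b) ^ (j + 1) := by gcongr
    _ < b * (1 / b) ^ (j + 1) := mul_lt_mul_of_pos_right hbε hpos
  exact hcontra.false

end Gap

theorem dist_lt_one_div_pow_of_cauchyRep {b : ℕ} (hb : 0 < b) {q : ℕ → ℕ} {y : X}
    (hq : (cauchyRep α hα).IsName q y) (i : ℕ) (hi : i ≠ 0) :
    dist (α (q (b * i))) y < (1 / b : ℝ) ^ i := by
  have hb' : (b : ℝ) < 2 ^ b := by exact_mod_cast Nat.lt_two_pow_self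
  refine (dist_le_of_cauchyRep hq _).trans_lt ?_
  rw [pow_mul, one_div_pow]
  exact pow_lt_pow_left₀ (one_div_lt_one_div_of_lt (by exact_mod_cast hb) hb')
    (by positivity) hi

open Classical in
theorem exists_typeTwoComputable_distTest (hprim : PrimrecMetric α) (o b : ℕ) :
    ∃ H, TypeTwoComputable H ∧ ∀ p q, ∃ s ∈ H (pairName p q), ∀ j,
      s j = if dist (α (q (b * (j + 1)))) (α o) < 2 * (1 / b : ℝ) ^ (j + 1) then 0 else 1 := by
  have hj : Primrec fun x : List ℕ × List ℕ => x.2.length + 1 :=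
    Primrec.succ.comp (Primrec.list_length.comp Primrec.snd)
  have hpos := Primrec.nat_mul.comp (Primrec.const b) hj
  have htest := hprim.primrecPred_dist_lt
    ((Primrec.list_getD 0).comp (primrec_pairSnd.comp Primrec.fst) hpos) (Primrec.const o)
    ((PrimrecRat.const 2).mul (PrimrecRat.pow (r := 1 / b) (by positivity) hj))
  obtain ⟨H, hH, hHs⟩ := exists_typeTwoComputable_rec (f := fun j => b * (j + 1) + 1)
    (Primrec.succ.comp (Primrec.nat_mul.comp (Primrec.const b) Primrec.succ))
    (Primrec.ite htest (Primrec.const 0) (Primrec.const 1)).to₂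
  refine ⟨H, hH, fun p q => ?_⟩
  obtain ⟨s, hs, hsj⟩ := hHs (pairName p q)
  refine ⟨s, hs, fun j => ?_⟩
  rw [hsj]
  simp only [pairSnd_initialWord, length_initialWord, getD_initialWord q (Nat.lt_succ_self _)]
  push_cast
  rfl

theorem sort_reducible_approxProj (hprim : PrimrecMetric α) (he : Primrec e) {o b : ℕ}
    (hdist : ∀ i, dist (α (e i)) (α o) = (1 / b : ℝ) ^ i) (hb : 3 ≤ b) {ε : ℝ} (hε : 0 < ε)
    (hbε : 1 + ε < b) :
    WeihrauchReducible cantorRep cantorRep (fun p : ℕ → Fin 2 => {sortFun p})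
      ((cauchyRep α hα).prod (positiveRep α hα)) (cauchyRep α hα) (approxProj ε) := by
  classical
  obtain ⟨K, hK, hKr⟩ := exists_typeTwoComputable_zeroCountClosed (hα := hα) hprim he o
  obtain ⟨H, hH, hHs⟩ := exists_typeTwoComputable_distTest hprim o b
  refine ⟨H, K, hH, hK, fun G hG p x hp _ => ?_⟩
  obtain ⟨r, hr, hrn⟩ := hKr p
  obtain ⟨q, hq, y, hy, hqy⟩ := hG r _ hrn (approxProj_nonempty hε _)
  obtain ⟨s, hs, hsj⟩ := hHs p q
  refine ⟨s, Part.mem_bind hr (Part.mem_bind hq hs), _, rfl, fun j => ?_⟩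
  have hb0 : 0 < b := by omega
  have herr := dist_lt_one_div_pow_of_cauchyRep hb0 hqy (j + 1) j.succ_ne_zero
  rw [hsj]
  by_cases hj : ∃ k, j < Nat.count (fun i => p i = 0) k
  · have hnear := dist_le_of_lt_count hdist hb0 hε hbε hy hj.choose_spec
    rw [if_pos (by linarith [dist_triangle (α (q (b * (j + 1)))) y (α o)]),
      (sortFun_eq_zero_iff hp j).2 hj]
    rfl
  · have hfar := one_div_pow_le_dist_of_forall_count_le hdist hb0 hy.1 (by simpa using hj)
    have h3 : (3 : ℝ) * (1 / b) ^ (j + 1) ≤ (1 / b) ^ j := by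
      rw [one_div_natCast_pow_eq hb0 j]
      gcongr
      exact_mod_cast hb
    rw [if_neg (by linarith [dist_triangle_left y (α o) (α (q (b * (j + 1))))]),
      Fin.eq_one_of_ne_zero _ (mt (sortFun_eq_zero_iff hp j).1 hj)]
    rfl

end SortToProj

section EuclideanScale

/-- A code of the rational point `b⁻ⁱ • e₀` of `ℝⁿ`. -/
def scalePoint (b i : ℕ) : ℕ := Nat.pair (Nat.pair (Nat.pair 1 0) (b ^ i - 1)) 0

theorem primrec_scalePoint (b : ℕ) : Primrec (scalePoint b) :=
  Primrec₂.natPair.comp (Primrec₂.natPair.comp (Primrec.const _)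
    (Primrec.nat_sub.comp (primrec_pow.comp (Primrec.const b) Primrec.id) (Primrec.const 1)))
    (Primrec.const 0)

theorem codeEntry_zero (i : ℕ) : codeEntry 0 i = 0 := by
  have h : (fun m => (Nat.unpair m).2)^[i] 0 = 0 := Function.iterate_fixed (by simp) i
  simp [codeEntry, h]

theorem ratPoint_zero (n : ℕ) : ratPoint n 0 = 0 := by
  ext i
  simp [ratPoint, codeEntry_zero, ratEnum]

theorem ratPoint_scalePoint {n b : ℕ} (hn : 1 ≤ n) (hb : 0 < b) (i : ℕ) :
    ratPoint n (scalePoint b i) = EuclideanSpace.single ⟨0, hn⟩ ((1 / b : ℝ) ^ i) := by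
  have hcast : ((b ^ i - 1 : ℕ) : ℝ) + 1 = (b : ℝ) ^ i := by
    exact_mod_cast Nat.sub_add_cancel (Nat.one_le_pow i b hb)
  have htail (j : ℕ) : codeEntry (scalePoint b i) (j + 1) = 0 := by
    simpa [codeEntry, scalePoint] using codeEntry_zero j
  ext ⟨j, hj⟩
  cases j with
  | zero => simp [ratPoint, codeEntry, scalePoint, ratEnum, hcast]
  | succ j => simp [ratPoint, htail, ratEnum]

theorem dist_scalePoint {n b : ℕ} (hn : 1 ≤ n) (hb : 0 < b) (i : ℕ) :
    dist (ratPoint n (scalePoint b i)) (ratPoint n 0) = (1 / b : ℝ) ^ i := by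
  rw [ratPoint_scalePoint hn hb, ratPoint_zero, dist_zero_right, PiLp.norm_single,
    Real.norm_of_nonneg (by positivity)]

end EuclideanScale

/-! ### Reducing approximate projection to sorting -/

section ProjToSort

variable {X : Type*} [MetricSpace X] {α : ℕ → X} {hα : DenseRange α} {p r : ℕ → ℕ} {x : X}
  {A : NonemptyClosed X}

section BallWithin

variable (α) in
/-- The test by which a machine detects that a ball lies within distance `v` of a point `x`: `b` is
the index of the ball, and `α a` approximates `x` up to `2⁻ᵏ`. -/
def BallWithin (a b k : ℕ) (v : ℝ) : Prop :=
  dist (α a) (α b.unpair.1) < v - nonnegRatEnum b.unpair.2 - (1 / 2) ^ k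

theorem PrimrecMetric.primrecPred_ballWithin (hprim : PrimrecMetric α) {σ : Type*} [Primcodable σ]
    {a b k : σ → ℕ} {v : σ → ℚ} (ha : Primrec a) (hb : Primrec b) (hk : Primrec k)
    (hv : PrimrecRat v) : PrimrecPred fun s => BallWithin α (a s) (b s) (k s) (v s) := by
  have hball := Primrec.unpair.comp hb
  refine (hprim.primrecPred_dist_lt ha (Primrec.fst.comp hball)
    ((hv.sub (PrimrecRat.nonnegRatEnum.comp (Primrec.snd.comp hball))).sub
      (PrimrecRat.pow (r := 1 / 2) (by norm_num) hk))).of_eq fun s => ?_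
  rw [BallWithin]
  push_cast
  rfl

theorem BallWithin.dist_lt {a b k : ℕ} {v : ℝ} (h : BallWithin α a b k v) {y : X}
    (hx : dist (α a) x ≤ (1 / 2) ^ k) (hy : y ∈ basicBall α b) : dist x y < v := by
  rw [BallWithin] at h
  rw [basicBall, mem_ball] at hy
  have htri := dist_triangle_left x y (α a)
  have htri' := dist_triangle_right (α a) y (α b.unpair.1)
  linarith

theorem eventually_ballWithin {b : ℕ} {v : ℝ} (hp : (cauchyRep α hα).IsName p x)
    (h : dist x (α b.unpair.1) + nonnegRatEnum b.unpair.2 < v) :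
    ∀ᶠ k in atTop, BallWithin α (p k) b k v := by
  have hlim := ((hp.2.dist (tendsto_const_nhds (x := α b.unpair.1))).add_const
    (nonnegRatEnum b.unpair.2 : ℝ)).add tendsto_half_pow
  rw [add_zero] at hlim
  filter_upwards [hlim.eventually_lt_const h] with k hk
  rw [BallWithin]
  linarith

theorem frequently_ballWithin (hp : (cauchyRep α hα).IsName p x)
    (hr : (positiveRep α hα).IsName r A) {a : X} (ha : a ∈ A.1) {v : ℝ} (hv : dist x a < v)
    {η : ℝ} (hη : 0 < η) :
    ∃ᶠ k in atTop, BallWithin α (p k) (r k.unpair.1) k v ∧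
      dist a (α (r k.unpair.1).unpair.1) < η ∧
      (nonnegRatEnum (r k.unpair.1).unpair.2 : ℝ) < η := by
  obtain ⟨b, hab, hrad⟩ :=
    exists_mem_basicBall_radius_lt hα a (lt_min hη (half_pos (sub_pos.2 hv)))
  obtain ⟨t, rfl⟩ := (hr b).2 ⟨a, hab, ha⟩
  have hcentre := (mem_ball.1 hab).trans hrad
  rw [lt_min_iff] at hcentre hrad
  obtain ⟨K, hK⟩ := eventually_atTop.1 (eventually_ballWithin hp (b := r t) (v := v) (by
    linarith [dist_triangle x a (α (r t).unpair.1)]))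
  refine frequently_atTop.2 fun l => ?_
  have hle := Nat.right_le_pair t (max l K)
  refine ⟨Nat.pair t (max l K), (le_max_left _ _).trans hle, ?_⟩
  simp only [Nat.unpair_pair]
  exact ⟨hK _ ((le_max_right _ _).trans hle), hcentre.1, hrad.1⟩

theorem infDist_lt_of_ballWithin (hp : (cauchyRep α hα).IsName p x)
    (hr : (positiveRep α hα).IsName r A) {k t : ℕ} {v : ℝ} (h : BallWithin α (p k) (r t) k v) :
    infDist x A.1 < v := by
  obtain ⟨a, hab, haA⟩ := (hr (r t)).1 ⟨t, rfl⟩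
  exact (infDist_le_dist_of_mem haA).trans_lt (h.dist_lt (dist_le_of_cauchyRep hp k) hab)

end BallWithin

section Level

variable {B : ℕ → ℕ → ℕ} {ρ : ℚ}

variable (B ρ) in
/-- The `j`-th term of a geometric sequence with ratio `ρ` that starts above the distance from a
point to a closed set whose names begin with the symbols paired in `c`. Here `B` bounds the
distances between the points of the dense sequence. -/
def level (c j : ℕ) : ℚ :=
  (1 + B c.unpair.1 c.unpair.2.unpair.1 + nonnegRatEnum c.unpair.2.unpair.2) * ρ ^ j

theorem primrecRat_level (hB : Primrec₂ B) (hρ : 0 ≤ ρ) {σ : Type*} [Primcodable σ] {c j : σ → ℕ}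
    (hc : Primrec c) (hj : Primrec j) : PrimrecRat fun s => level B ρ (c s) (j s) :=
  have hu := Primrec.unpair.comp hc
  have hball := Primrec.unpair.comp (Primrec.snd.comp hu)
  (((PrimrecRat.const 1).add (PrimrecRat.natCast
    (hB.comp (Primrec.fst.comp hu) (Primrec.fst.comp hball)))).add
      (PrimrecRat.nonnegRatEnum.comp (Primrec.snd.comp hball))).mul (PrimrecRat.pow hρ hj)

theorem level_succ (c j : ℕ) : level B ρ c (j + 1) = ρ * level B ρ c j := by
  rw [level, level, pow_succ]
  ring

theorem level_antitone (hρ : 0 ≤ ρ) (hρ' : ρ ≤ 1) (c : ℕ) :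
    Antitone fun j => (level B ρ c j : ℝ) := fun i j hij => by
  have hrad := nonnegRatEnum_nonneg c.unpair.2.unpair.2
  exact Rat.cast_le.2
    (mul_le_mul_of_nonneg_left (pow_le_pow_of_le_one hρ hρ' hij) (by positivity))

theorem tendsto_level (hρ : 0 ≤ ρ) (hρ' : ρ < 1) (c : ℕ) :
    Tendsto (fun j => (level B ρ c j : ℝ)) atTop (𝓝 0) := by
  have hpow : Tendsto (fun j : ℕ => (ρ : ℝ) ^ j) atTop (𝓝 0) :=
    tendsto_pow_atTop_nhds_zero_of_lt_one (by exact_mod_cast hρ) (by exact_mod_cast hρ')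
  simpa [level] using hpow.const_mul _

theorem infDist_lt_level_zero (hB : ∀ k l, dist (α k) (α l) ≤ B k l)
    (hp : (cauchyRep α hα).IsName p x) (hr : (positiveRep α hα).IsName r A) :
    infDist x A.1 < level B ρ (pairName p r 0) 0 := by
  obtain ⟨a, hab, haA⟩ := (hr (r 0)).1 ⟨0, rfl⟩
  have hxp : dist x (α (p 0)) ≤ 1 := by simpa [dist_comm] using dist_le_of_cauchyRep hp 0
  calc infDist x A.1 ≤ dist x a := infDist_le_dist_of_mem haA
    _ ≤ dist x (α (p 0)) + dist (α (p 0)) (α (r 0).unpair.1) + dist (α (r 0).unpair.1) a :=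
      dist_triangle4 ..
    _ < 1 + B (p 0) (r 0).unpair.1 + nonnegRatEnum (r 0).unpair.2 :=
      add_lt_add_of_le_of_lt (add_le_add hxp (hB _ _)) (mem_ball'.1 hab)
    _ = level B ρ (pairName p r 0) 0 := by simp [level, pairName]

end Level

section LevelTest

open Classical in
theorem exists_typeTwoComputable_levelTest (hprim : PrimrecMetric α) {B : ℕ → ℕ → ℕ}
    (hB : Primrec₂ B) {ρ : ℚ} (hρ : 0 ≤ ρ) :
    ∃ K, TypeTwoComputable K ∧ ∀ p r, ∃ c ∈ K (pairName p r), ∀ k,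
      c k = if BallWithin α (p k) (r k.unpair.1) k
        (level B ρ (pairName p r 0) (Nat.count (fun i => c i = 0) k + 1)) then 0 else 1 := by
  have hk : Primrec fun x : List ℕ × List ℕ => x.2.length := Primrec.list_length.comp Primrec.snd
  have htest := hprim.primrecPred_ballWithin
    ((Primrec.list_getD 0).comp (primrec_pairFst.comp Primrec.fst) hk)
    ((Primrec.list_getD 0).comp (primrec_pairSnd.comp Primrec.fst)
      (Primrec.fst.comp (Primrec.unpair.comp hk))) hk
    (primrecRat_level hB hρ ((Primrec.list_getD 0).comp Primrec.fst (Primrec.const 0))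
      (Primrec.succ.comp ((primrec_list_count 0).comp Primrec.snd)))
  obtain ⟨K, hK, hKc⟩ := exists_typeTwoComputable_rec (f := (· + 1)) Primrec.succ
    (Primrec.ite htest (Primrec.const 0) (Primrec.const 1)).to₂
  refine ⟨K, hK, fun p r => ?_⟩
  obtain ⟨c, hc, hck⟩ := hKc (pairName p r)
  refine ⟨c, hc, fun k => (hck k).trans ?_⟩
  simp only [pairFst_initialWord, pairSnd_initialWord, length_initialWord, count_zero_initialWord,
    getD_initialWord _ (Nat.lt_succ_self k), getD_initialWord _ (Nat.succ_pos k),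
    getD_initialWord _ (Nat.lt_succ_of_le (Nat.unpair_left_le k))]

open Classical in
theorem exists_isName_sortFun_eq_zero_iff (hp : (cauchyRep α hα).IsName p x)
    (hr : (positiveRep α hα).IsName r A) {v : ℕ → ℝ} (hv : Antitone v) {c : ℕ → ℕ}
    (hc : ∀ k, c k = if BallWithin α (p k) (r k.unpair.1) k
      (v (Nat.count (fun i => c i = 0) k + 1)) then 0 else 1) :
    ∃ z, cantorRep.IsName c z ∧ ∀ j, sortFun z j = 0 ↔ infDist x A.1 < v (j + 1) := by
  have hname : cantorRep.IsName c fun i => if c i = 0 then 0 else 1 := fun i => by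
    have h01 : c i = 0 ∨ c i = 1 := by
      rw [hc]
      split_ifs <;> simp
    rcases h01 with h | h <;> simp [h]
  refine ⟨_, hname, fun j => ?_⟩
  rw [sortFun_eq_zero_iff hname]
  refine exists_lt_count_iff_of_greedy (Q := fun j => infDist x A.1 < v (j + 1))
    (P := fun j k => BallWithin α (p k) (r k.unpair.1) k (v (j + 1)))
    (fun k => ?_) (fun i j hij h => h.trans_le (hv (Nat.add_le_add_right hij 1)))
    (fun j k h => infDist_lt_of_ballWithin hp hr h) (fun j h => ?_) j
  · rw [hc k]
    split_ifs with h <;> simp [h]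
  · obtain ⟨a, haA, ha⟩ := (infDist_lt_iff A.2.2).1 h
    exact (frequently_ballWithin hp hr haA ha one_pos).mono fun k hk => hk.1

end LevelTest

section Machine

variable {B : ℕ → ℕ → ℕ} {ρ : ℚ}

variable (α) in
/-- The ball with index `b` may be used to extend the output `out` of the search for a point of the
closed set: it is small, and its centre is close to the last output point. -/
def RefiningBall (out : List ℕ) (b : ℕ) : Prop :=
  nonnegRatEnum b.unpair.2 < (1 / 2 : ℚ) ^ (out.length + 2) ∧
    (out = [] ∨
      dist (α (out.getD (out.length - 1) 0)) (α b.unpair.1) < (1 / 2) ^ (out.length + 1))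

theorem PrimrecMetric.primrecPred_refiningBall (hprim : PrimrecMetric α) {σ : Type*}
    [Primcodable σ] {out : σ → List ℕ} {b : σ → ℕ} (hout : Primrec out) (hb : Primrec b) :
    PrimrecPred fun s => RefiningBall α (out s) (b s) := by
  have hlen := Primrec.list_length.comp hout
  have hball := Primrec.unpair.comp hb
  have hpow (c : ℕ) : PrimrecRat fun s => (1 / 2 : ℚ) ^ ((out s).length + c) :=
    PrimrecRat.pow (by norm_num) (Primrec.nat_add.comp hlen (Primrec.const c))
  have hnear := hprim.primrecPred_dist_lt ((Primrec.list_getD 0).comp hout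
    (Primrec.nat_sub.comp hlen (Primrec.const 1))) (Primrec.fst.comp hball) (hpow 1)
  refine (((PrimrecRat.nonnegRatEnum.comp (Primrec.snd.comp hball)).lt (hpow 2)).and
    ((Primrec.eq.comp hout (Primrec.const [])).or hnear)).of_eq fun s => ?_
  rw [RefiningBall]
  push_cast
  rfl

variable (B ρ) in
/-- Having read `u`, a word of pairs `⟨p i, r i⟩`, copy the approximation of `x` named by `p` as
long as the current level shows that `x` is close to the closed set. The offset `4` leaves room for
the distance from `x` to the closed set if the search takes over later. -/
def followStep (u out : List ℕ) : Option ℕ :=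
  if out.length + 4 < u.length ∧ level B ρ (u.getD 0 0) u.length < (1 / 2) ^ (out.length + 4)
    then some ((pairFst u).getD (out.length + 4) 0) else none

open Classical in
variable (α B ρ) in
/-- Having read `u`, a word of pairs `⟨p i, r i⟩`, output the centre of a refining ball that meets
the closed set and lies within the level `m` of `x`. The last position read codes the ball. -/
noncomputable def searchStep (m : ℕ) (u out : List ℕ) : Option ℕ :=
  if BallWithin α ((pairFst u).getD (u.length - 1) 0)
        ((pairSnd u).getD (u.length - 1).unpair.1 0) (u.length - 1) (level B ρ (u.getD 0 0) m) ∧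
      RefiningBall α out ((pairSnd u).getD (u.length - 1).unpair.1 0)
    then some ((pairSnd u).getD (u.length - 1).unpair.1 0).unpair.1 else none

/-- The number of zeros at the beginning of a word. -/
def leadingZeros (w : List ℕ) : ℕ := w.findIdx (· ≠ 0)

variable (α B ρ) in
/-- The machine that finds an approximate projection with the help of the sorted sequence. It reads
triples `⟨⟨p i, r i⟩, s i⟩`; the number of leading zeros of `s` is the last level above the distance
from `x` to the closed set. -/
noncomputable def projStep (w out : List ℕ) : Option ℕ :=
  if leadingZeros (pairSnd w) < w.length
    then searchStep α B ρ (leadingZeros (pairSnd w)) (pairFst w) out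
    else followStep B ρ (pairFst w) out

theorem primrec_followStep (hB : Primrec₂ B) (hρ : 0 ≤ ρ) : Primrec₂ (followStep B ρ) :=
  have hlen := Primrec.list_length.comp (Primrec.fst (α := List ℕ) (β := List ℕ))
  have hi := Primrec.nat_add.comp (Primrec.list_length.comp (Primrec.snd (α := List ℕ)
    (β := List ℕ))) (Primrec.const 4)
  have hlevel := primrecRat_level hB hρ
    ((Primrec.list_getD 0).comp Primrec.fst (Primrec.const 0)) hlen
  Primrec.ite ((Primrec.nat_lt.comp hi hlen).and (hlevel.lt (PrimrecRat.pow (by norm_num) hi)))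
    (Primrec.option_some.comp ((Primrec.list_getD 0).comp (primrec_pairFst.comp Primrec.fst) hi))
    (Primrec.const none)

theorem primrec_searchStep (hprim : PrimrecMetric α) (hB : Primrec₂ B) (hρ : 0 ≤ ρ) {σ : Type*}
    [Primcodable σ] {m : σ → ℕ} {u out : σ → List ℕ} (hm : Primrec m) (hu : Primrec u)
    (hout : Primrec out) : Primrec fun s => searchStep α B ρ (m s) (u s) (out s) := by
  classical
  have hk := Primrec.nat_sub.comp (Primrec.list_length.comp hu) (Primrec.const 1)
  have ha := (Primrec.list_getD 0).comp (primrec_pairFst.comp hu) hk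
  have hb := (Primrec.list_getD 0).comp (primrec_pairSnd.comp hu)
    (Primrec.fst.comp (Primrec.unpair.comp hk))
  have hlevel := primrecRat_level hB hρ ((Primrec.list_getD 0).comp hu (Primrec.const 0)) hm
  exact Primrec.ite ((hprim.primrecPred_ballWithin ha hb hk hlevel).and
    (hprim.primrecPred_refiningBall hout hb))
    (Primrec.option_some.comp (Primrec.fst.comp (Primrec.unpair.comp hb))) (Primrec.const none)

theorem primrec_leadingZeros : Primrec leadingZeros :=
  Primrec.list_findIdx Primrec.id
    (PrimrecPred.not (Primrec.eq.comp Primrec.snd (Primrec.const 0))).decide.to₂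

theorem primrec_projStep (hprim : PrimrecMetric α) (hB : Primrec₂ B) (hρ : 0 ≤ ρ) :
    Primrec₂ (projStep α B ρ) :=
  have hm := primrec_leadingZeros.comp (primrec_pairSnd.comp (Primrec.fst (β := List ℕ)))
  have hu := primrec_pairFst.comp (Primrec.fst (β := List ℕ))
  Primrec.ite (Primrec.nat_lt.comp hm (Primrec.list_length.comp Primrec.fst))
    (primrec_searchStep hprim hB hρ hm hu Primrec.snd)
    ((primrec_followStep hB hρ).comp hu Primrec.snd)

theorem leadingZeros_initialWord_of_forall {s : ℕ → ℕ} {k : ℕ} (hs : ∀ j < k, s j = 0) :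
    leadingZeros (initialWord s k) = k := by
  refine (List.findIdx_eq_length.2 fun v hv => ?_).trans (length_initialWord s k)
  obtain ⟨i, hi, rfl⟩ := List.getElem_of_mem hv
  simpa using hs i (by simpa using hi)

theorem leadingZeros_initialWord {s : ℕ → ℕ} {m k : ℕ} (hs : ∀ j < m, s j = 0) (hm : s m ≠ 0)
    (hk : m < k) : leadingZeros (initialWord s k) = m := by
  rw [leadingZeros, List.findIdx_eq (by simpa using hk)]
  exact ⟨by simpa using hm, fun j hj => by simpa using hs j hj⟩

theorem projStep_eq_some_iff_of_forall {s : ℕ → ℕ} {k : ℕ} (hs : ∀ j < k + 1, s j = 0)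
    {out : List ℕ} {c : ℕ} :
    projStep α B ρ (initialWord (pairName (pairName p r) s) (k + 1)) out = some c ↔
      (out.length + 4 < k + 1 ∧
        (level B ρ (pairName p r 0) (k + 1) : ℝ) < (1 / 2) ^ (out.length + 4)) ∧
      p (out.length + 4) = c := by
  have hcast : level B ρ (pairName p r 0) (k + 1) < (1 / 2) ^ (out.length + 4) ↔
      (level B ρ (pairName p r 0) (k + 1) : ℝ) < (1 / 2) ^ (out.length + 4) := by
    rw [← Rat.cast_lt (K := ℝ)]
    push_cast
    rfl
  rw [projStep, pairSnd_initialWord, leadingZeros_initialWord_of_forall hs, length_initialWord,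
    if_neg (lt_irrefl _), followStep, pairFst_initialWord, pairFst_initialWord, length_initialWord,
    getD_initialWord _ (Nat.succ_pos k), Option.ite_none_right_eq_some, Option.some_inj, hcast]
  exact and_congr_right fun h => by rw [getD_initialWord _ h.1]

theorem projStep_eq_some_iff_of_le {s : ℕ → ℕ} {k m : ℕ} (hs : ∀ j < m, s j = 0) (hm : s m ≠ 0)
    (hk : m ≤ k) {out : List ℕ} {c : ℕ} :
    projStep α B ρ (initialWord (pairName (pairName p r) s) (k + 1)) out = some c ↔
      (BallWithin α (p k) (r k.unpair.1) k (level B ρ (pairName p r 0) m) ∧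
        RefiningBall α out (r k.unpair.1)) ∧ (r k.unpair.1).unpair.1 = c := by
  have hmk : m < k + 1 := Nat.lt_succ_of_le hk
  rw [projStep, pairSnd_initialWord, leadingZeros_initialWord hs hm hmk, length_initialWord,
    if_pos hmk, searchStep, pairFst_initialWord, pairFst_initialWord, pairSnd_initialWord,
    length_initialWord, Nat.add_sub_cancel, getD_initialWord _ (Nat.succ_pos k),
    getD_initialWord _ (Nat.lt_succ_self k),
    getD_initialWord _ (Nat.lt_succ_of_le (Nat.unpair_left_le k)),
    Option.ite_none_right_eq_some, Option.some_inj]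

end Machine

section Near

variable {v : ℝ}

variable (α x) in
/-- The point `α c` is admissible as the `i`-th approximation of a point of `A` within distance `v`
of `x`: it is close to some such point. -/
def IsNear (A : Set X) (v : ℝ) (c i : ℕ) : Prop :=
  ∃ a ∈ A, dist x a < v ∧ dist (α c) a < (1 / 2) ^ (i + 2)

theorem isNear_of_lt (hp : (cauchyRep α hα).IsName p x) (hv : infDist x A.1 < v) {i : ℕ}
    (hvi : v < (1 / 2) ^ (i + 4)) : IsNear α x A.1 v (p (i + 4)) i := by
  obtain ⟨a, haA, ha⟩ := (infDist_lt_iff A.2.2).1 hv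
  refine ⟨a, haA, ha, ?_⟩
  calc dist (α (p (i + 4))) a ≤ dist (α (p (i + 4))) x + dist x a := dist_triangle ..
    _ < (1 / 2) ^ (i + 4) + (1 / 2) ^ (i + 4) :=
      add_lt_add_of_le_of_lt (dist_le_of_cauchyRep hp _) (ha.trans hvi)
    _ = (1 / 2) ^ (i + 3) := by ring
    _ ≤ (1 / 2) ^ (i + 2) := half_pow_anti (Nat.le_succ _)

theorem isNear_of_refiningBall (hp : (cauchyRep α hα).IsName p x)
    (hr : (positiveRep α hα).IsName r A) {k t : ℕ} {out : List ℕ}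
    (hwithin : BallWithin α (p k) (r t) k v) (hball : RefiningBall α out (r t)) :
    IsNear α x A.1 v (r t).unpair.1 out.length := by
  obtain ⟨a, hab, haA⟩ := (hr (r t)).1 ⟨t, rfl⟩
  have hrad : (nonnegRatEnum (r t).unpair.2 : ℝ) < (1 / 2) ^ (out.length + 2) := by
    have h := (Rat.cast_lt (K := ℝ)).2 hball.1
    push_cast at h
    exact h
  exact ⟨a, haA, hwithin.dist_lt (dist_le_of_cauchyRep hp k) hab, (mem_ball'.1 hab).trans hrad⟩

theorem IsNear.dist_succ_le (hp : (cauchyRep α hα).IsName p x) {S : Set X} {c i : ℕ}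
    (h : IsNear α x S v c i) (hvi : v < (1 / 2) ^ (i + 5)) :
    dist (α c) (α (p (i + 5))) ≤ (1 / 2) ^ (i + 1) := by
  obtain ⟨a, -, hxa, hca⟩ := h
  have hxp := dist_le_of_cauchyRep hp (i + 5)
  rw [dist_comm] at hxa hxp
  calc dist (α c) (α (p (i + 5))) ≤ dist (α c) a + dist a x + dist x (α (p (i + 5))) :=
      dist_triangle4 ..
    _ ≤ (1 / 2) ^ (i + 2) + (1 / 2) ^ (i + 5) + (1 / 2) ^ (i + 5) := by
      gcongr
      exact (hxa.trans hvi).le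
    _ = (1 / 2) ^ (i + 2) + (1 / 2) ^ (i + 4) := by ring
    _ ≤ (1 / 2) ^ (i + 2) + (1 / 2) ^ (i + 2) :=
      add_le_add_right (half_pow_anti (Nat.add_le_add_left (by norm_num) i)) _
    _ = (1 / 2) ^ (i + 1) := by ring

theorem frequently_refiningBall (hp : (cauchyRep α hα).IsName p x)
    (hr : (positiveRep α hα).IsName r A) (hv : infDist x A.1 < v) {out : List ℕ}
    (hout : ∀ l c, out = l ++ [c] → IsNear α x A.1 v c l.length) :
    ∃ᶠ k in atTop, BallWithin α (p k) (r k.unpair.1) k v ∧ RefiningBall α out (r k.unpair.1) := by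
  obtain ⟨a, haA, hxa, η, hη, hrad, hlast⟩ : ∃ a ∈ A.1, dist x a < v ∧ ∃ η : ℝ, 0 < η ∧
      η ≤ (1 / 2) ^ (out.length + 2) ∧ (out = [] ∨
        dist (α (out.getD (out.length - 1) 0)) a + η ≤ (1 / 2) ^ (out.length + 1)) := by
    rcases List.eq_nil_or_concat' out with rfl | ⟨l, c, rfl⟩
    · obtain ⟨a, haA, hxa⟩ := (infDist_lt_iff A.2.2).1 hv
      exact ⟨a, haA, hxa, _, by positivity, le_rfl, Or.inl rfl⟩
    · obtain ⟨a, haA, hxa, hca⟩ := hout l c rfl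
      refine ⟨a, haA, hxa, _, lt_min (by positivity) (sub_pos.2 hca), min_le_left _ _, Or.inr ?_⟩
      simp [← le_sub_iff_add_le']
  refine (frequently_ballWithin hp hr haA hxa hη).mono fun k hk => ?_
  obtain ⟨hwithin, hcentre, hsmall⟩ := hk
  refine ⟨hwithin, ?_, hlast.imp_right fun h => ?_⟩
  · rw [← Rat.cast_lt (K := ℝ)]
    push_cast
    exact hsmall.trans_le hrad
  · linarith [dist_triangle (α (out.getD (out.length - 1) 0)) a (α (r k.unpair.1).unpair.1)]

theorem exists_isName_of_forall_isNear [CompleteSpace X] {S : Set X} (hS : IsClosed S)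
    {q : ℕ → ℕ} (hnear : ∀ i, IsNear α x S v (q i) i)
    (hsucc : ∀ i, dist (α (q i)) (α (q (i + 1))) ≤ (1 / 2) ^ (i + 1)) :
    ∃ y ∈ S, dist x y ≤ v ∧ (cauchyRep α hα).IsName q y := by
  obtain ⟨y, hy⟩ := exists_cauchyRep_isName_of_dist_succ_le (hα := hα) hsucc
  choose a haS hxa hqa using hnear
  have hay : Tendsto a atTop (𝓝 y) :=
    hy.2.congr_dist (squeeze_zero (fun _ => dist_nonneg) (fun i => (hqa i).le)
      ((tendsto_add_atTop_iff_nat 2).2 tendsto_half_pow))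
  exact ⟨y, hS.mem_of_tendsto hay (Eventually.of_forall haS),
    le_of_tendsto (tendsto_const_nhds.dist hay) (Eventually.of_forall fun i => (hxa i).le), hy⟩

end Near

section Correctness

variable {B : ℕ → ℕ → ℕ} {ρ : ℚ} {s : ℕ → ℕ}

theorem exists_mem_machineFun_projStep_of_forall (hρ : 0 ≤ ρ) (hρ' : ρ < 1)
    (hs : ∀ j, s j = 0) (hp : (cauchyRep α hα).IsName p x) :
    ∃ q ∈ machineFun (projStep α B ρ) (pairName (pairName p r) s),
      (cauchyRep α hα).IsName q x := by
  obtain ⟨q, hq, hstep⟩ := exists_mem_machineFun (ψ := projStep α B ρ)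
    (p := pairName (pairName p r) s) (fun _ => True) trivial (fun _ _ _ _ _ => trivial)
    fun out _ => by
      refine Eventually.frequently ?_
      filter_upwards [((tendsto_add_atTop_iff_nat 1).2 (tendsto_level hρ hρ' _)).eventually_lt_const
        (by positivity : (0 : ℝ) < (1 / 2) ^ (out.length + 4)),
        eventually_ge_atTop (out.length + 4)] with k hlevel hk
      exact Option.isSome_iff_exists.2 ⟨_, (projStep_eq_some_iff_of_forall fun j _ => hs j).2
        ⟨⟨Nat.lt_succ_of_le hk, hlevel⟩, rfl⟩⟩
  have hqp : q = fun i => p (i + 4) := funext fun i => by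
    obtain ⟨-, k, hk⟩ := hstep i
    rw [projStep_eq_some_iff_of_forall fun j _ => hs j, length_initialWord] at hk
    exact hk.2.symm
  exact ⟨q, hq, hqp ▸ cauchyRep_isName_shift hp 4⟩

section FirstNonzero

variable {m k : ℕ} (hρ : 0 ≤ ρ) (hρ' : ρ ≤ 1) (hs : ∀ j < m, s j = 0) (hm : s m ≠ 0)
  (hp : (cauchyRep α hα).IsName p x)

include hρ hρ' hs in
theorem projStep_eq_some_of_lt (hk : k < m) {out : List ℕ} {c : ℕ}
    (h : projStep α B ρ (initialWord (pairName (pairName p r) s) (k + 1)) out = some c) :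
    (level B ρ (pairName p r 0) m : ℝ) < (1 / 2) ^ (out.length + 4) ∧ c = p (out.length + 4) := by
  rw [projStep_eq_some_iff_of_forall fun j hj => hs j (by omega)] at h
  exact ⟨(level_antitone hρ hρ' _ (Nat.succ_le_of_lt hk)).trans_lt h.1.2, h.2.symm⟩

include hρ hρ' hs hm hp

theorem isNear_of_projStep_eq_some (hr : (positiveRep α hα).IsName r A)
    (hv : infDist x A.1 < level B ρ (pairName p r 0) m) {out : List ℕ} {c : ℕ}
    (h : projStep α B ρ (initialWord (pairName (pairName p r) s) (k + 1)) out = some c) :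
    IsNear α x A.1 (level B ρ (pairName p r 0) m) c out.length := by
  rcases Nat.lt_or_ge k m with hk | hk
  · obtain ⟨hlevel, rfl⟩ := projStep_eq_some_of_lt hρ hρ' hs hk h
    exact isNear_of_lt hp hv hlevel
  · obtain ⟨⟨hwithin, hball⟩, rfl⟩ := (projStep_eq_some_iff_of_le hs hm hk).1 h
    exact isNear_of_refiningBall hp hr hwithin hball

theorem dist_succ_le_of_projStep_eq_some {S : Set X} {q : ℕ → ℕ} {i : ℕ}
    (hnear : IsNear α x S (level B ρ (pairName p r 0) m) (q i) i)
    (h : projStep α B ρ (initialWord (pairName (pairName p r) s) (k + 1))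
      (initialWord q (i + 1)) = some (q (i + 1))) :
    dist (α (q i)) (α (q (i + 1))) ≤ (1 / 2) ^ (i + 1) := by
  rcases Nat.lt_or_ge k m with hk | hk
  · obtain ⟨hlevel, hq⟩ := projStep_eq_some_of_lt hρ hρ' hs hk h
    rw [length_initialWord] at hlevel hq
    rw [hq]
    exact hnear.dist_succ_le hp hlevel
  · obtain ⟨⟨-, -, hlast⟩, hq⟩ := (projStep_eq_some_iff_of_le hs hm hk).1 h
    rw [hq, length_initialWord, Nat.add_sub_cancel, getD_initialWord _ (Nat.lt_succ_self i)]
      at hlast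
    exact (hlast.resolve_left (by simp [initialWord_succ])).le.trans
      (half_pow_anti (Nat.le_succ _))

theorem exists_mem_machineFun_projStep [CompleteSpace X] (hr : (positiveRep α hα).IsName r A)
    (hv : infDist x A.1 < level B ρ (pairName p r 0) m) :
    ∃ q ∈ machineFun (projStep α B ρ) (pairName (pairName p r) s),
      ∃ y ∈ A.1, dist x y ≤ level B ρ (pairName p r 0) m ∧ (cauchyRep α hα).IsName q y := by
  obtain ⟨q, hq, hstep⟩ := exists_mem_machineFun (ψ := projStep α B ρ)
    (p := pairName (pairName p r) s)
    (fun out => ∀ l c, out = l ++ [c] →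
      IsNear α x A.1 (level B ρ (pairName p r 0) m) c l.length)
    (by simp)
    (fun k out c _ hc l c' hl => by
      obtain ⟨rfl, rfl⟩ : out = l ∧ c = c' := by simpa using hl
      exact isNear_of_projStep_eq_some hρ hρ' hs hm hp hr hv hc)
    (fun out hout => by
      refine ((frequently_refiningBall hp hr hv hout).and_eventually
        (eventually_ge_atTop m)).mono fun k hk => ?_
      exact Option.isSome_iff_exists.2
        ⟨_, (projStep_eq_some_iff_of_le hs hm hk.2).2 ⟨hk.1, rfl⟩⟩)
  have hnear (i : ℕ) : IsNear α x A.1 (level B ρ (pairName p r 0) m) (q i) i := by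
    simpa using (hstep (i + 1)).1 _ _ (initialWord_succ q i)
  refine ⟨q, hq, exists_isName_of_forall_isNear A.2.1 hnear fun i => ?_⟩
  obtain ⟨-, k, hk⟩ := hstep (i + 1)
  exact dist_succ_le_of_projStep_eq_some hρ hρ' hs hm hp (hnear i) hk

end FirstNonzero

theorem exists_mem_machineFun_projStep_approxProj [CompleteSpace X]
    (hB : ∀ k l, dist (α k) (α l) ≤ B k l) (hρ : 0 < ρ) (hρ' : ρ < 1) {ε : ℝ}
    (hε : 1 ≤ (1 + ε) * ρ) (hp : (cauchyRep α hα).IsName p x) (hr : (positiveRep α hα).IsName r A)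
    (hs : ∀ j, s j = 0 ↔ infDist x A.1 < level B ρ (pairName p r 0) (j + 1)) :
    ∃ q ∈ machineFun (projStep α B ρ) (pairName (pairName p r) s),
      ∃ y ∈ approxProj ε (x, A), (cauchyRep α hα).IsName q y := by
  classical
  by_cases hzero : ∀ j, s j = 0
  · have hd : infDist x A.1 = 0 := le_antisymm
      (ge_of_tendsto ((tendsto_add_atTop_iff_nat 1).2 (tendsto_level hρ.le hρ' _))
        (Eventually.of_forall fun j => ((hs j).1 (hzero j)).le)) infDist_nonneg
    obtain ⟨q, hq, hqx⟩ := exists_mem_machineFun_projStep_of_forall hρ.le hρ' hzero hp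
    exact ⟨q, hq, x, ⟨(A.2.1.mem_iff_infDist_zero A.2.2).2 hd, by simp [hd]⟩, hqx⟩
  · obtain ⟨m, hm, hlt⟩ : ∃ m, s m ≠ 0 ∧ ∀ j < m, s j = 0 := by
      have hex := not_forall.1 hzero
      exact ⟨Nat.find hex, Nat.find_spec hex, fun j hj => not_not.1 (Nat.find_min hex hj)⟩
    have hbelow : infDist x A.1 < level B ρ (pairName p r 0) m := by
      cases m with
      | zero => exact infDist_lt_level_zero hB hp hr
      | succ m => exact (hs m).1 (hlt m (Nat.lt_succ_self m))
    have habove : (ρ * level B ρ (pairName p r 0) m : ℝ) ≤ infDist x A.1 := by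
      simpa [level_succ] using mt (hs m).2 hm
    obtain ⟨q, hq, y, hyA, hy, hqy⟩ :=
      exists_mem_machineFun_projStep hρ.le hρ'.le hlt hm hp hr hbelow
    refine ⟨q, hq, y, ⟨hyA, hy.trans ?_⟩, hqy⟩
    have hlevel : (0 : ℝ) ≤ level B ρ (pairName p r 0) m := infDist_nonneg.trans hbelow.le
    have hε' : 0 ≤ 1 + ε := by
      by_contra! hneg
      have : (1 + ε) * ρ < 0 := mul_neg_of_neg_of_pos hneg (by exact_mod_cast hρ)
      linarith
    calc (level B ρ (pairName p r 0) m : ℝ) ≤ (1 + ε) * ρ * level B ρ (pairName p r 0) m :=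
        le_mul_of_one_le_left hlevel hε
      _ = (1 + ε) * (ρ * level B ρ (pairName p r 0) m) := mul_assoc ..
      _ ≤ (1 + ε) * infDist x A.1 := by gcongr

end Correctness

theorem exists_rat_one_le_mul {ε : ℝ} (hε : 0 < ε) :
    ∃ ρ : ℚ, 0 < ρ ∧ ρ < 1 ∧ 1 ≤ (1 + ε) * ρ := by
  have hpos : 0 < 1 + ε := by linarith
  obtain ⟨ρ, hερ, hρ⟩ := exists_rat_btwn (by rw [div_lt_one hpos]; linarith : 1 / (1 + ε) < 1)
  exact ⟨ρ, by exact_mod_cast (one_div_pos.2 hpos).trans hερ, by exact_mod_cast hρ,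
    (div_le_iff₀' hpos).1 hερ.le⟩

theorem approxProj_reducible_sort [CompleteSpace X] (hprim : PrimrecMetric α) {ε : ℝ}
    (hε : 0 < ε) :
    WeihrauchReducible ((cauchyRep α hα).prod (positiveRep α hα)) (cauchyRep α hα) (approxProj ε)
      cantorRep cantorRep (fun p : ℕ → Fin 2 => {sortFun p}) := by
  obtain ⟨B, hB, hBdist⟩ := hprim.exists_bound
  obtain ⟨ρ, hρ, hρ', hερ⟩ := exists_rat_one_le_mul hε
  obtain ⟨K, hK, hKc⟩ := exists_typeTwoComputable_levelTest hprim hB hρ.le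
  refine ⟨machineFun (projStep α B ρ), K,
    typeTwoComputable_machineFun (primrec_projStep hprim hB hρ.le), hK, ?_⟩
  rintro G hG _ ⟨x, A⟩ ⟨p, r, rfl, hp, hr⟩ -
  obtain ⟨c, hc, hck⟩ := hKc p r
  obtain ⟨z, hz, hsort⟩ :=
    exists_isName_sortFun_eq_zero_iff hp hr (level_antitone hρ.le hρ'.le _) hck
  obtain ⟨s, hs, _, rfl, hsz⟩ := hG c z hz ⟨_, rfl⟩
  obtain ⟨q, hq, hqy⟩ := exists_mem_machineFun_projStep_approxProj hBdist hρ hρ' hερ hp hr fun j =>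
    (apply_eq_zero_iff_of_cantorRep hsz j).trans (hsort j)
  exact ⟨q, Part.mem_bind hc (Part.mem_bind hs hq), hqy⟩

end ProjToSort

theorem mainTheorem8_general {X : Type*} [MetricSpace X] [CompleteSpace X] {α : ℕ → X}
    {hα : DenseRange α} (hprim : PrimrecMetric α) {e : ℕ → ℕ} (he : Primrec e) {o b : ℕ}
    (hdist : ∀ i, dist (α (e i)) (α o) = (1 / b : ℝ) ^ i) (hb : 3 ≤ b) {ε : ℝ} (hε : 0 < ε)
    (hbε : 1 + ε < b) :
    WeihrauchEquivalent ((cauchyRep α hα).prod (positiveRep α hα)) (cauchyRep α hα)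
      (approxProj ε) cantorRep cantorRep (fun p : ℕ → Fin 2 => {sortFun p}) :=
  ⟨approxProj_reducible_sort hprim hε, sort_reducible_approxProj hprim he hdist hb hε hbε⟩

theorem mainTheorem8 (ε : ℝ) (hε : 0 < ε) (n : ℕ) (hn : 1 ≤ n) :
    WeihrauchEquivalent
      ((euclideanRep n).prod (euclideanClosedRep n)) (euclideanRep n)
      (approxProj (X := EuclideanSpace ℝ (Fin n)) ε)
      cantorRep cantorRep (fun p : ℕ → Fin 2 => {sortFun p}) := by
  obtain ⟨b, hb⟩ := exists_nat_gt (3 + ε)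
  have hb3 : 3 ≤ b := by exact_mod_cast (by linarith : (3 : ℝ) ≤ b)
  exact mainTheorem8_general (primrecMetric_ratPoint n) (primrec_scalePoint b)
    (dist_scalePoint hn (by omega)) hb3 hε (by linarith)
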